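/- **Theorem.** A convex body in $\mathbb{R}^n$ is a compact convex set with non-empty interior; it is in John's position if the closed Euclidean unit ball $B_2^n$ is the ellipsoid of maximal volume contained in $K$. Write $|K|$ for the volume of $K$, $S(K)$ for its surface area (the $(n-1)$-dimensional Hausdorff measure of the boundary of $K$), and, if $0\in\mathrm{int}(K)$, $M(K)=\int_{S^{n-1}}\|\xi\|_K\,d\sigma(\xi)$, where $\|x\|_K=\min\{t\ge 0: x\in tK\}$ and $\sigma$ is the rotationally invariant probability measure on the unit sphere $S^{n-1}$. There is an absolute constant $c>0$ such that for every $n\ge 2$ and every convex body $K$ in $\mathbb{R}^n$ which is in John's position, $$S(K)\le c\,\frac{n^{3/2}}{\sqrt{\log n}}\,|K|\,M(K).$$ This is sharp up to the value of the constant: for every $n\ge 2$ the cube $Q_n=[-1,1]^n$ is in John's position, and there is an absolute constant $c'>0$ such that for every $n\ge 2$, $$S(Q_n)\ge c'\,\frac{n^{3/2}}{\sqrt{\log n}}\,|Q_n|\,M(Q_n).$$ -/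

import Mathlib

open MeasureTheory Metric

noncomputable section

/-- A convex body in `ℝⁿ`: a compact convex set with non-empty interior. -/
structure IsConvexBody {n : ℕ} (K : Set (EuclideanSpace ℝ (Fin n))) : Prop where
  convex : Convex ℝ K
  isCompact : IsCompact K
  nonempty_interior : (interior K).Nonempty

/-- An ellipsoid in `ℝⁿ`: the image `A(B₂ⁿ) + b` of the closed Euclidean unit ball under an
invertible affine map. -/
def IsEllipsoid {n : ℕ} (E : Set (EuclideanSpace ℝ (Fin n))) : Prop :=
  ∃ (A : EuclideanSpace ℝ (Fin n) ≃ₗ[ℝ] EuclideanSpace ℝ (Fin n)) (b : EuclideanSpace ℝ (Fin n)),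
    E = (fun x => A x + b) '' closedBall 0 1

/-- A convex body `K` is in John's position if the closed Euclidean unit ball is an ellipsoid of
maximal volume inscribed in `K`. -/
structure IsJohnPosition {n : ℕ} (K : Set (EuclideanSpace ℝ (Fin n))) : Prop where
  isConvexBody : IsConvexBody K
  closedBall_subset : closedBall 0 1 ⊆ K
  volume_le : ∀ E : Set (EuclideanSpace ℝ (Fin n)), IsEllipsoid E → E ⊆ K →
    volume E ≤ volume (closedBall (0 : EuclideanSpace ℝ (Fin n)) 1)

/-- The surface area `S(K)`: the `(n-1)`-dimensional Hausdorff measure of the boundary of `K`,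
normalized so that in `ℝⁿ⁻¹` it is Lebesgue measure. -/
def surfaceArea {n : ℕ} (K : Set (EuclideanSpace ℝ (Fin n))) : ENNReal :=
  μHE[n - 1] (frontier K)

/-- The rotationally invariant probability measure `σ` on the unit sphere `Sⁿ⁻¹` (`n ≥ 1`):
the spherical Lebesgue measure divided by its total mass. -/
def sphereProb (n : ℕ) : Measure (sphere (0 : EuclideanSpace ℝ (Fin n)) 1) :=
  ((volume : Measure (EuclideanSpace ℝ (Fin n))).toSphere Set.univ)⁻¹ •
    (volume : Measure (EuclideanSpace ℝ (Fin n))).toSphere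

/-- `M(K) = ∫_{Sⁿ⁻¹} ‖ξ‖_K dσ(ξ)`, where `‖·‖_K` is the Minkowski functional of `K`. -/
def meanGauge {n : ℕ} (K : Set (EuclideanSpace ℝ (Fin n))) : ℝ :=
  ∫ ξ : sphere (0 : EuclideanSpace ℝ (Fin n)) 1, gauge K ξ.1 ∂(sphereProb n)

/-- The cube `Q_n = [-1,1]ⁿ`. -/
def unitCube (n : ℕ) : Set (EuclideanSpace ℝ (Fin n)) :=
  {x | ∀ i, x i ∈ Set.Icc (-1 : ℝ) 1}

end

/-!
Two facts about a body `K` in John's position give the upper bound.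

*Surface area.* Since `K` contains the unit ball, `S(K) ≤ n |K|`
(`Convex.euclideanHausdorffMeasure_frontier_le`). Squeeze a polytope `P` between `K` and `r K`,
`r > 1`. The nearest-point map of `K` is `1`-Lipschitz and maps the facets of `P` onto the boundary
of `K`, so `S(K)` is at most the total area of the facets. The pyramids over the facets with apex
`0` are disjoint and have height at least `1`, so this area is at most `n |P| ≤ n r ^ n |K|`;
let `r → 1`.

*Mean gauge.* `M(K) ≥ c √(log n / n)` (`exists_sqrt_log_le_integral_gauge`). In polar coordinates,
the Gaussian mean of the gauge is `M(K)` times the Gaussian mean of the norm, which is of order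
`√n`. A contact point `u` of the ball with the boundary of `K` satisfies `⟪u, x⟫ ≤ ‖x‖_K`, since the
supporting hyperplane of `K` at `u` is tangent to the ball. By the Dvoretzky–Rogers argument
(`IsJohnPosition.exists_contact`), maximality of the ball yields, for every `m`-dimensional
subspace, a contact point whose projection onto it has squared norm at most `m / n`. Hence the
first `√n` greedily chosen contact points are so close to an orthonormal system that replacing one by the other
changes the expected maximum only by a constant, and the maximum of `√n` independent normal
variables is of order `√(log n)`. When `log n` is bounded, a single contact point suffices.

For the cube, John's position is Hadamard's inequality for the rows of the linear map defining an
inscribed ellipsoid. The facets give `S(Q_n) ≥ n |Q_n| / 2`, and an exponential moment bound for the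
maximum of `n` normal variables gives `M(Q_n) ≤ C √(log n / n)`.
-/

open scoped RealInnerProductSpace Pointwise
open ProbabilityTheory

/-! ### Circumscribed polytopes and the nearest-point map -/

section Polytope

variable {V : Type*} [NormedAddCommGroup V] [InnerProductSpace ℝ V] [FiniteDimensional ℝ V]

lemma Convex.exists_inner_le_of_mem_frontier {K : Set V} (hK : Convex ℝ K)
    (hint : (interior K).Nonempty) {x : V} (hx : x ∈ frontier K) :
    ∃ v : V, v ≠ 0 ∧ ∀ y ∈ K, ⟪v, y⟫ ≤ ⟪v, x⟫ := by
  obtain ⟨f, hf⟩ := geometric_hahn_banach_open_point hK.interior isOpen_interior hx.2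
  obtain ⟨a, ha⟩ := hint
  refine ⟨(InnerProductSpace.toDual ℝ V).symm f, ?_, ?_⟩
  · intro h
    have h0 : f = 0 := by simpa using h
    have := hf a ha
    simp [h0] at this
  · intro y hy
    have hy' : y ∈ closure (interior K) := by
      rw [hK.closure_interior_eq_closure_of_nonempty_interior ⟨a, ha⟩]
      exact subset_closure hy
    have hcl : closure (interior K) ⊆ {z | f z ≤ f x} :=
      closure_minimal (fun z hz => (hf z hz).le) (isClosed_le f.continuous continuous_const)
    simpa using hcl hy'

/-- The nearest-point map of a closed convex set, described by its variational inequality. -/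
lemma Convex.exists_lipschitzWith_one_projection {K : Set V} (hK : Convex ℝ K) (hc : IsClosed K)
    (hne : K.Nonempty) :
    ∃ p : V → V, LipschitzWith 1 p ∧
      ∀ z, ∀ x ∈ K, (∀ y ∈ K, ⟪z - x, y - x⟫ ≤ 0) → p z = x := by
  have h : ∀ z : V, ∃ x ∈ K, ∀ y ∈ K, ⟪z - x, y - x⟫ ≤ 0 := fun z => by
    obtain ⟨x, hx, hmin⟩ := exists_norm_eq_iInf_of_complete_convex hne hc.isComplete hK z
    exact ⟨x, hx, (norm_eq_iInf_iff_real_inner_le_zero hK hx).1 hmin⟩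
  choose p hp hpz using h
  have key : ∀ z w x, x ∈ K → (∀ y ∈ K, ⟪w - x, y - x⟫ ≤ 0) → ‖p z - x‖ ≤ ‖z - w‖ := by
    intro z w x hx hwx
    have h1 := hpz z x hx
    have h2 := hwx (p z) (hp z)
    have h3 : ‖p z - x‖ ^ 2 ≤ ⟪z - w, p z - x⟫ := by
      rw [← real_inner_self_eq_norm_sq]
      have e : ⟪z - w, p z - x⟫ = ⟪p z - x, p z - x⟫ - ⟪z - p z, x - p z⟫ - ⟪w - x, p z - x⟫ := by
        simp only [inner_sub_left, inner_sub_right]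
        ring
      linarith
    have h4 := real_inner_le_norm (z - w) (p z - x)
    by_contra hlt
    push Not at hlt
    have : 0 < ‖p z - x‖ := lt_of_le_of_lt (norm_nonneg _) hlt
    nlinarith
  refine ⟨p, LipschitzWith.of_dist_le_mul fun z w => ?_, fun z x hx hzx => ?_⟩
  · simpa [dist_eq_norm] using key z w (p w) (hp w) (hpz w)
  · have := key z z x hx hzx
    rw [sub_self, norm_zero] at this
    exact sub_eq_zero.1 (norm_le_zero_iff.1 this)

/-- A convex body containing the unit ball is squeezed between a polytope and a dilate of itself;
the facets of the polytope are at distance at least `1` from the origin. -/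
lemma Convex.exists_polytope {K : Set V} (hK : Convex ℝ K) (hcpt : IsCompact K)
    (hB : closedBall 0 1 ⊆ K) {r : ℝ} (hr : 1 < r) :
    ∃ (N : ℕ) (u : Fin N → V) (h : Fin N → ℝ), (∀ i, ‖u i‖ = 1) ∧ (∀ i, 1 ≤ h i) ∧
      (∀ x ∈ K, ∀ i, ⟪u i, x⟫ ≤ h i) ∧ ∀ x, (∀ i, ⟪u i, x⟫ ≤ h i) → x ∈ r • K := by
  have h0 : K ∈ nhds (0 : V) := Filter.mem_of_superset (closedBall_mem_nhds 0 one_pos) hB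
  have hr0 : 0 < r := by linarith
  have hsep : ∀ x : V, x ∉ K → ∃ (u : V) (h : ℝ), ‖u‖ = 1 ∧ 1 ≤ h ∧ (∀ y ∈ K, ⟪u, y⟫ ≤ h) ∧
      h < ⟪u, x⟫ := by
    intro x hx
    obtain ⟨f, s, hfs, hsx⟩ := geometric_hahn_banach_closed_point hK hcpt.isClosed hx
    set w := (InnerProductSpace.toDual ℝ V).symm f with hw
    have hfw : ∀ y, f y = ⟪w, y⟫ := fun y => by simp [hw]
    have hs0 : 0 < s := by
      have := hfs 0 (mem_of_mem_nhds h0)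
      simpa using this
    have hw0 : w ≠ 0 := by
      intro h
      have := hfw x
      rw [h, inner_zero_left] at this
      linarith
    have hwn : 0 < ‖w‖ := norm_pos_iff.2 hw0
    have hun : ‖‖w‖⁻¹ • w‖ = 1 := by
      rw [norm_smul, norm_inv, norm_norm, inv_mul_cancel₀ hwn.ne']
    have hle : ∀ y ∈ K, ⟪‖w‖⁻¹ • w, y⟫ ≤ ‖w‖⁻¹ * s := fun y hy => by
      rw [real_inner_smul_left, ← hfw]
      exact mul_le_mul_of_nonneg_left (hfs y hy).le (inv_nonneg.2 hwn.le)
    refine ⟨‖w‖⁻¹ • w, ‖w‖⁻¹ * s, hun, ?_, hle, ?_⟩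
    · refine le_trans ?_ (hle (‖w‖⁻¹ • w) (hB ?_))
      · rw [real_inner_self_eq_norm_sq, hun, one_pow]
      · simp [hun]
    · rw [real_inner_smul_left, ← hfw]
      exact mul_lt_mul_of_pos_left hsx (inv_pos.2 hwn)
  choose! u h hu hh huK hux using hsep
  have hgc := continuous_gauge hK h0
  have habs : Absorbent ℝ K := absorbent_nhds_zero h0
  have hmemiff : ∀ x, x ∈ K ↔ gauge K x ≤ 1 := fun x => by
    rw [gauge_le_one_iff_mem_closure hK h0, hcpt.isClosed.closure_eq]
  have hmem : ∀ x, x ∈ r • K ↔ gauge K x ≤ r := fun x => by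
    rw [Set.mem_smul_set_iff_inv_smul_mem₀ hr0.ne', hmemiff,
      gauge_smul_of_nonneg (inv_nonneg.2 hr0.le), smul_eq_mul, inv_mul_le_iff₀ hr0, mul_one]
  -- finitely many of the separating half-spaces cut off the whole boundary of `r • K`
  have hD : IsCompact {x : V | gauge K x = r} := by
    refine (hcpt.smul r).of_isClosed_subset (isClosed_eq hgc continuous_const) fun x hx => ?_
    exact (hmem x).2 (le_of_eq hx)
  obtain ⟨t, ht, hcov⟩ := hD.elim_nhds_subcover (fun x => {y | h x < ⟪u x, y⟫}) (fun x hx => by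
    refine (isOpen_lt continuous_const (by fun_prop)).mem_nhds (hux x ?_)
    rw [hmemiff, show gauge K x = r from hx]
    exact not_le.2 hr)
  have htK : ∀ x ∈ t, x ∉ K := fun x hx => by
    rw [hmemiff, show gauge K x = r from ht x hx]
    exact not_le.2 hr
  let e := t.equivFin.symm
  refine ⟨t.card, fun i => u (e i), fun i => h (e i), fun i => hu _ (htK _ (e i).2),
    fun i => hh _ (htK _ (e i).2), fun x hx i => huK _ (htK _ (e i).2) x hx, fun x hx => ?_⟩
  by_contra hxr
  rw [hmem, not_le] at hxr
  have hg : 0 < gauge K x := hr0.trans hxr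
  -- the radial projection of `x` to the boundary of `r • K` would still lie in the polytope
  have hc0 : 0 ≤ r / gauge K x := by positivity
  have hc1 : r / gauge K x ≤ 1 := (div_le_one hg).2 hxr.le
  have hy : (r / gauge K x) • x ∈ {x : V | gauge K x = r} := by
    change gauge K _ = r
    rw [gauge_smul_of_nonneg hc0, smul_eq_mul, div_mul_cancel₀ _ hg.ne']
  obtain ⟨z, hz, hzy⟩ := Set.mem_iUnion₂.1 (hcov hy)
  have hxz : ⟪u z, x⟫ ≤ h z := by
    have := hx (e.symm ⟨z, hz⟩)
    simpa using this
  have hzy' : h z < ⟪u z, (r / gauge K x) • x⟫ := hzy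
  rw [real_inner_smul_right] at hzy'
  have h1 := hh z (htK z hz)
  have h2 : r / gauge K x * ⟪u z, x⟫ ≤ r / gauge K x * h z := mul_le_mul_of_nonneg_left hxz hc0
  nlinarith

/-- Following an outer normal from a boundary point of `K` until it leaves the polytope shows that
the nearest-point map of `K` sends the facets of the polytope onto the boundary of `K`. -/
lemma Convex.frontier_subset_image_facets {K : Set V} (hK : Convex ℝ K) (hcpt : IsCompact K)
    (hint : (interior K).Nonempty) {N : ℕ} {u : Fin N → V} {h : Fin N → ℝ}
    (hKP : ∀ x ∈ K, ∀ i, ⟪u i, x⟫ ≤ h i)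
    (hb : Bornology.IsBounded {x : V | ∀ i, ⟪u i, x⟫ ≤ h i}) {p : V → V}
    (hp : ∀ z, ∀ x ∈ K, (∀ y ∈ K, ⟪z - x, y - x⟫ ≤ 0) → p z = x) :
    frontier K ⊆ p '' ⋃ i, {x : V | (∀ j, ⟪u j, x⟫ ≤ h j) ∧ ⟪u i, x⟫ = h i} := by
  intro x hx
  have hxK : x ∈ K := hcpt.isClosed.frontier_subset hx
  obtain ⟨v, hv0, hv⟩ := hK.exists_inner_le_of_mem_frontier hint hx
  set T : Set ℝ := {t | 0 ≤ t ∧ ∀ i, ⟪u i, x + t • v⟫ ≤ h i} with hT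
  have hTc : IsCompact T := by
    obtain ⟨R, hR⟩ := hb.exists_norm_le
    refine (isCompact_Icc (a := (0 : ℝ)) (b := (R + ‖x‖) / ‖v‖)).of_isClosed_subset ?_ ?_
    · simp only [hT, Set.ofPred_and, Set.ofPred_forall]
      exact isClosed_Ici.inter (isClosed_iInter fun i =>
        isClosed_le (by fun_prop) continuous_const)
    · rintro t ⟨ht0, ht⟩
      refine ⟨ht0, ?_⟩
      rw [le_div_iff₀ (norm_pos_iff.2 hv0)]
      have h1 := hR _ ht
      have h2 : ‖t • v‖ ≤ ‖x + t • v‖ + ‖x‖ := by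
        simpa using norm_sub_le (x + t • v) x
      rw [norm_smul, Real.norm_of_nonneg ht0] at h2
      linarith
  obtain ⟨t, ⟨ht0, ht⟩, hmax⟩ := hTc.exists_isMaxOn ⟨0, le_rfl, by simpa using hKP x hxK⟩
    continuousOn_id
  refine ⟨x + t • v, ?_, hp _ x hxK fun y hy => ?_⟩
  · by_contra hno
    simp only [Set.mem_iUnion, Set.mem_ofPred_eq, not_exists, not_and] at hno
    have hlt : ∀ i, ⟪u i, x + t • v⟫ < h i := fun i => lt_of_le_of_ne (ht i) (hno i ht)
    have hev : ∀ᶠ s in nhds t, ∀ i, ⟪u i, x + s • v⟫ < h i := by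
      rw [Filter.eventually_all]
      intro i
      have hci : Continuous fun s : ℝ => ⟪u i, x + s • v⟫ := by fun_prop
      exact hci.continuousAt.eventually_lt continuousAt_const (hlt i)
    obtain ⟨s, hs, hts⟩ := ((hev.filter_mono nhdsWithin_le_nhds).and
      (self_mem_nhdsWithin (s := Set.Ioi t))).exists
    have hts' : t < s := hts
    exact absurd (hmax (show s ∈ T from ⟨ht0.trans hts'.le, fun i => (hs i).le⟩)) (not_le.2 hts')
  · rw [add_sub_cancel_left, real_inner_smul_left, inner_sub_right]
    exact mul_nonpos_of_nonneg_of_nonpos ht0 (sub_nonpos.2 (hv y hy))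

end Polytope

/-! ### Surface area of a body containing the unit ball -/

lemma LipschitzWith.euclideanHausdorffMeasure_image_le {X Y : Type*} [EMetricSpace X]
    [MeasurableSpace X] [BorelSpace X] [EMetricSpace Y] [MeasurableSpace Y] [BorelSpace Y]
    {p : X → Y} (hp : LipschitzWith 1 p) (d : ℕ) (s : Set X) : μHE[d] (p '' s) ≤ μHE[d] s := by
  simp only [Measure.euclideanHausdorffMeasure_def, Measure.smul_apply]
  refine smul_le_smul_of_nonneg_left ?_ zero_le
  simpa using hp.hausdorffMeasure_image_le (d := d) (by positivity) s

section Cone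

variable {V : Type*} [NormedAddCommGroup V] [InnerProductSpace ℝ V] [FiniteDimensional ℝ V]

/-- The open cone with apex `0` over a subset `F` of the hyperplane `⟪u, x⟫ = h`. -/
def openCone (u : V) (h : ℝ) (F : Set V) : Set V :=
  {z | 0 < ⟪u, z⟫ ∧ ⟪u, z⟫ < h ∧ (h / ⟪u, z⟫) • z ∈ F}

variable [MeasurableSpace V] [BorelSpace V]

lemma measurableSet_openCone {u : V} {h : ℝ} {F : Set V} (hF : MeasurableSet F) :
    MeasurableSet (openCone u h F) := by
  have hm : Measurable fun z : V => ⟪u, z⟫ := by fun_prop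
  refine (measurableSet_lt measurable_const hm).inter
    ((measurableSet_lt hm measurable_const).inter ?_)
  exact ((measurable_const.div hm).smul measurable_id) hF

/-- A cone of height `h ≥ 1` over a base `F` in a `d`-dimensional space has volume
`h |F| / d ≥ |F| / d`, since its section at height `s` is the dilate of `F` by `s / h`. -/
lemma euclideanHausdorffMeasure_le_volume_openCone (hd : 0 < Module.finrank ℝ V)
    {u : V} {h : ℝ} {F : Set V} (hF : MeasurableSet F) (hu : ‖u‖ = 1) (hh : 1 ≤ h)
    (hFh : ∀ x ∈ F, ⟪u, x⟫ = h) :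
    μHE[Module.finrank ℝ V - 1] F ≤ Module.finrank ℝ V * volume (openCone u h F) := by
  set d := Module.finrank ℝ V with hdd
  have hh0 : 0 < h := by linarith
  have hu0 : u ≠ 0 := by
    rintro rfl
    simp at hu
  have huu : ⟪u, u⟫ = 1 := by rw [real_inner_self_eq_norm_sq, hu, one_pow]
  have hue : ‖u‖ₑ = 1 := by rw [← ofReal_norm, hu, ENNReal.ofReal_one]
  have hvol := EuclideanGeometry.euclideanHausdorffMeasure_eq_lintegral (0 : V) hu0
    (measurableSet_openCone (u := u) (h := h) hF)
  rw [InnerProductSpace.euclideanHausdorffMeasure_eq_volume, hue, one_mul] at hvol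
  have hsec : ∀ s ∈ Set.Ioo 0 h, ENNReal.ofReal ((s / h) ^ (d - 1)) * μHE[d - 1] F ≤
      μHE[d - 1] (openCone u h F ∩
        (AffineSubspace.mk' (s • u +ᵥ (0 : V)) (ℝ ∙ u)ᗮ : AffineSubspace ℝ V)) := by
    rintro s ⟨hs0, hsh⟩
    have hsh0 : 0 < s / h := div_pos hs0 hh0
    have e1 : ENNReal.ofReal ((s / h) ^ (d - 1)) * μHE[d - 1] F = μHE[d - 1] ((s / h) • F) := by
      rw [Measure.euclideanHausdorffMeasure_smul₀ _ hsh0.ne', ENNReal.smul_def, smul_eq_mul,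
        ENNReal.ofReal_pow hsh0.le]
      congr 2
      push_cast
      rw [← enorm_eq_nnnorm, Real.enorm_of_nonneg hsh0.le]
    rw [e1]
    refine measure_mono ?_
    rintro _ ⟨x, hx, rfl⟩
    have hux : ⟪u, (s / h) • x⟫ = s := by
      rw [real_inner_smul_right, hFh x hx, div_mul_cancel₀ _ hh0.ne']
    refine ⟨⟨by rw [hux]; exact hs0, by rw [hux]; exact hsh, ?_⟩, ?_⟩
    · rw [hux, smul_smul, div_mul_div_comm, mul_comm h s, div_self (by positivity), one_smul]
      exact hx
    · change (s / h) • x ∈ AffineSubspace.mk' (s • u +ᵥ (0 : V)) (ℝ ∙ u)ᗮ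
      rw [AffineSubspace.mem_mk', Submodule.mem_orthogonal_singleton_iff_inner_right]
      simp only [vadd_eq_add, add_zero, vsub_eq_sub]
      rw [inner_sub_right, hux, real_inner_smul_right, huu, mul_one, sub_self]
  have hint : ∫⁻ s in Set.Ioo 0 h, ENNReal.ofReal ((s / h) ^ (d - 1)) = ENNReal.ofReal (h / d) := by
    rw [restrict_Ioo_eq_restrict_Ioc, ← ofReal_integral_eq_lintegral_ofReal]
    · rw [← intervalIntegral.integral_of_le hh0.le]
      congr 1
      have : ∀ s : ℝ, (s / h) ^ (d - 1) = (h ^ (d - 1))⁻¹ * s ^ (d - 1) := fun s => by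
        rw [div_pow, div_eq_inv_mul]
      simp_rw [this]
      rw [intervalIntegral.integral_const_mul, integral_pow]
      have hd1 : d - 1 + 1 = d := Nat.succ_pred_eq_of_pos hd
      have hd2 : ((d - 1 : ℕ) : ℝ) + 1 = d := by exact_mod_cast hd1
      rw [hd2, hd1, zero_pow hd.ne', sub_zero]
      have : h ^ d = h ^ (d - 1) * h := by rw [← pow_succ, hd1]
      rw [this]
      field_simp
    · exact (by fun_prop : Continuous fun s : ℝ => (s / h) ^ (d - 1)).integrableOn_Ioc
    · exact (ae_restrict_iff' measurableSet_Ioc).2 (Filter.Eventually.of_forall fun s hs =>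
        pow_nonneg (div_nonneg hs.1.le hh0.le) _)
  have hd0 : (d : ENNReal) ≠ 0 := by exact_mod_cast hd.ne'
  calc μHE[d - 1] F = d * (ENNReal.ofReal (1 / d) * μHE[d - 1] F) := by
        rw [ENNReal.ofReal_div_of_pos (by exact_mod_cast hd), ENNReal.ofReal_one,
          ENNReal.ofReal_natCast, one_div, ← mul_assoc, ENNReal.mul_inv_cancel hd0 (by simp),
          one_mul]
    _ ≤ d * (ENNReal.ofReal (h / d) * μHE[d - 1] F) := by gcongr
    _ = d * ∫⁻ s in Set.Ioo 0 h, ENNReal.ofReal ((s / h) ^ (d - 1)) * μHE[d - 1] F := by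
        rw [lintegral_mul_const _ (by fun_prop), hint]
    _ ≤ d * volume (openCone u h F) := by
        rw [hvol]
        refine mul_le_mul' le_rfl ?_
        exact (setLIntegral_mono' measurableSet_Ioo hsec).trans (setLIntegral_le_lintegral _ _)

/-- Pyramids over the facets of a polytope whose facets are at distance at least `1` from the
origin do not overlap, so the facets have total area at most `d` times the volume. -/
lemma euclideanHausdorffMeasure_facets_le (hd : 0 < Module.finrank ℝ V) {N : ℕ} {u : Fin N → V}
    {h : Fin N → ℝ} (hu : ∀ i, ‖u i‖ = 1) (hh : ∀ i, 1 ≤ h i) :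
    μHE[Module.finrank ℝ V - 1] (⋃ i, {x : V | (∀ j, ⟪u j, x⟫ ≤ h j) ∧ ⟪u i, x⟫ = h i}) ≤
      Module.finrank ℝ V * volume {x : V | ∀ j, ⟪u j, x⟫ ≤ h j} := by
  set F : Fin N → Set V := fun i => {x : V | (∀ j, ⟪u j, x⟫ ≤ h j) ∧ ⟪u i, x⟫ = h i} with hFdef
  have hFm : ∀ i, MeasurableSet (F i) := fun i => by
    have : IsClosed (F i) := by
      simp only [hFdef, Set.ofPred_and, Set.ofPred_forall]
      exact (isClosed_iInter fun j => isClosed_le (by fun_prop) continuous_const).inter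
        (isClosed_eq (by fun_prop) continuous_const)
    exact this.measurableSet
  have hsub : ∀ i, disjointed F i ⊆ F i := fun i => disjointed_subset F i
  have hDm : ∀ i, MeasurableSet (disjointed F i) := fun i => by
    rw [disjointed_apply, Finset.sup_eq_iSup]
    exact (hFm i).diff (Finset.measurableSet_biUnion _ fun j _ => hFm j)
  have hdisj : Pairwise (Function.onFun Disjoint fun i =>
      openCone (u i) (h i) (disjointed F i)) := by
    intro i j hij
    refine Set.disjoint_left.2 fun z hzi hzj => ?_
    obtain ⟨hi0, hih, hiF⟩ := hzi
    obtain ⟨hj0, hjh, hjF⟩ := hzj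
    -- the ray through `z` meets the boundary of the polytope only once
    have key : ∀ a b, z ∈ openCone (u a) (h a) (disjointed F a) →
        z ∈ openCone (u b) (h b) (disjointed F b) → h a / ⟪u a, z⟫ ≤ h b / ⟪u b, z⟫ := by
      rintro a b ⟨ha0, -, haF⟩ ⟨hb0, -, -⟩
      have := (hsub a haF).1 b
      rw [real_inner_smul_right] at this
      rwa [le_div_iff₀ hb0]
    have heq := le_antisymm (key i j ⟨hi0, hih, hiF⟩ ⟨hj0, hjh, hjF⟩)
      (key j i ⟨hj0, hjh, hjF⟩ ⟨hi0, hih, hiF⟩)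
    rw [heq] at hiF
    exact Set.disjoint_left.1 (disjoint_disjointed F hij) hiF hjF
  calc μHE[Module.finrank ℝ V - 1] (⋃ i, F i)
      ≤ ∑ i, μHE[Module.finrank ℝ V - 1] (disjointed F i) := by
        rw [← iUnion_disjointed (f := F)]
        exact measure_iUnion_fintype_le _ _
    _ ≤ ∑ i, Module.finrank ℝ V * volume (openCone (u i) (h i) (disjointed F i)) := by
        refine Finset.sum_le_sum fun i _ => ?_
        exact euclideanHausdorffMeasure_le_volume_openCone hd (hDm i) (hu i) (hh i)
          fun x hx => (hsub i hx).2
    _ = Module.finrank ℝ V * volume (⋃ i, openCone (u i) (h i) (disjointed F i)) := by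
        rw [measure_iUnion hdisj fun i => measurableSet_openCone (hDm i), tsum_fintype,
          Finset.mul_sum]
    _ ≤ Module.finrank ℝ V * volume {x : V | ∀ j, ⟪u j, x⟫ ≤ h j} := by
        gcongr
        refine Set.iUnion_subset fun i z hz j => ?_
        obtain ⟨h0, hlt, hzF⟩ := hz
        have hj := (hsub i hzF).1 j
        rw [real_inner_smul_right] at hj
        have h1 : 1 < h i / ⟪u i, z⟫ := (one_lt_div h0).2 hlt
        have h2 := hh j
        by_contra hcon
        push Not at hcon
        nlinarith

/-- If a convex body in a `d`-dimensional space contains the unit ball, then its surface area is at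
most `d` times its volume. -/
theorem Convex.euclideanHausdorffMeasure_frontier_le (hd : 0 < Module.finrank ℝ V) {K : Set V}
    (hK : Convex ℝ K) (hcpt : IsCompact K) (hB : closedBall 0 1 ⊆ K) :
    μHE[Module.finrank ℝ V - 1] (frontier K) ≤ Module.finrank ℝ V * volume K := by
  have hint : (interior K).Nonempty :=
    ⟨0, mem_interior_iff_mem_nhds.2 (Filter.mem_of_superset (closedBall_mem_nhds 0 one_pos) hB)⟩
  obtain ⟨p, hpL, hp⟩ := hK.exists_lipschitzWith_one_projection hcpt.isClosed
    (hint.mono interior_subset)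
  set d := Module.finrank ℝ V
  have hbound : ∀ r : ℝ, 1 < r →
      μHE[d - 1] (frontier K) ≤ ENNReal.ofReal (r ^ d) * (d * volume K) := by
    intro r hr
    obtain ⟨N, u, h, hu, hh, hKP, hPK⟩ := hK.exists_polytope hcpt hB hr
    have hsub := hK.frontier_subset_image_facets hcpt hint hKP
      ((hcpt.smul r).isBounded.subset hPK) hp
    calc μHE[d - 1] (frontier K) ≤ d * volume {x : V | ∀ j, ⟪u j, x⟫ ≤ h j} :=
          (measure_mono hsub).trans ((hpL.euclideanHausdorffMeasure_image_le _ _).trans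
            (euclideanHausdorffMeasure_facets_le hd hu hh))
      _ ≤ d * volume (r • K) := by gcongr; exact hPK
      _ = ENNReal.ofReal (r ^ d) * (d * volume K) := by
          rw [Measure.addHaar_smul, abs_of_nonneg (by positivity)]
          ring
  have hlim : Filter.Tendsto (fun r : ℝ => ENNReal.ofReal (r ^ d) * (d * volume K))
      (nhdsWithin 1 (Set.Ioi 1)) (nhds (ENNReal.ofReal (1 ^ d) * (d * volume K))) := by
    refine ENNReal.Tendsto.mul_const ?_ (Or.inl (by simp))
    refine ENNReal.tendsto_ofReal ?_
    exact ((continuous_pow d).tendsto 1).mono_left nhdsWithin_le_nhds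
  have := ge_of_tendsto hlim (Filter.eventually_of_mem self_mem_nhdsWithin hbound)
  simpa using this

end Cone

/-! ### The standard Gaussian measure in polar coordinates -/

section Gaussian

variable {V : Type*} [NormedAddCommGroup V] [InnerProductSpace ℝ V] [FiniteDimensional ℝ V]
  [MeasurableSpace V] [BorelSpace V]

/-- Both measures have the same characteristic function. -/
lemma stdGaussian_eq_withDensity :
    stdGaussian V = (volume : Measure V).withDensity fun x =>
      ENNReal.ofReal ((2 * Real.pi) ^ (-(Module.finrank ℝ V : ℝ) / 2) * Real.exp (-‖x‖ ^ 2 / 2)) := by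
  set c : ℝ := (2 * Real.pi) ^ (-(Module.finrank ℝ V : ℝ) / 2) with hc
  have hc0 : 0 < c := Real.rpow_pos_of_pos (by positivity) _
  have hmeas : Measurable fun x : V => ENNReal.ofReal (c * Real.exp (-‖x‖ ^ 2 / 2)) := by fun_prop
  have hintg : Integrable (fun x : V => c * Real.exp (-‖x‖ ^ 2 / 2)) := by
    have h := (GaussianFourier.integrable_cexp_neg_mul_sq_norm_add (V := V) (b := 1 / 2)
      (by norm_num) 0 0).norm
    refine (h.congr (Filter.Eventually.of_forall fun x => ?_)).const_mul c
    have e : -(1 / 2 : ℂ) * (‖x‖ : ℂ) ^ 2 + 0 * ((⟪0, x⟫ : ℝ) : ℂ) = ((-‖x‖ ^ 2 / 2 : ℝ) : ℂ) := by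
      push_cast
      ring
    simp only [e, Complex.norm_exp, Complex.ofReal_re]
  have : IsFiniteMeasure ((volume : Measure V).withDensity fun x =>
      ENNReal.ofReal (c * Real.exp (-‖x‖ ^ 2 / 2))) :=
    isFiniteMeasure_withDensity_ofReal hintg.2
  refine Measure.ext_of_charFun ?_
  ext t
  rw [charFun_stdGaussian, charFun_apply, integral_withDensity_eq_integral_toReal_smul hmeas
    (Filter.Eventually.of_forall fun x => ENNReal.ofReal_lt_top)]
  have hG := GaussianFourier.integral_cexp_neg_mul_sq_norm_add (V := V) (b := 1 / 2)
    (by norm_num) Complex.I t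
  have e : ∀ x : V, (ENNReal.ofReal (c * Real.exp (-‖x‖ ^ 2 / 2))).toReal •
      Complex.exp (⟪x, t⟫ * Complex.I) =
      c * Complex.exp (-(1 / 2) * (‖x‖ : ℂ) ^ 2 + Complex.I * ⟪t, x⟫) := fun x => by
    rw [ENNReal.toReal_ofReal (by positivity), Complex.real_smul, Complex.ofReal_mul,
      Complex.ofReal_exp, mul_assoc, ← Complex.exp_add, real_inner_comm]
    congr 2
    push_cast
    ring
  simp_rw [e]
  rw [integral_const_mul, hG, ← mul_assoc]
  have h1 : (c : ℂ) * ((Real.pi : ℂ) / (1 / 2)) ^ ((Module.finrank ℝ V : ℂ) / 2) = 1 := by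
    have h2 : ((Real.pi : ℂ) / (1 / 2)) ^ ((Module.finrank ℝ V : ℂ) / 2) =
        (((2 * Real.pi) ^ ((Module.finrank ℝ V : ℝ) / 2) : ℝ) : ℂ) := by
      rw [Complex.ofReal_cpow (by positivity)]
      push_cast
      congr 1
      ring
    rw [h2, ← Complex.ofReal_mul, hc, ← Real.rpow_add (by positivity)]
    simp [neg_div]
  rw [h1, one_mul]
  congr 1
  rw [Complex.I_sq]
  ring

/-- Integration in polar coordinates of a positively homogeneous function against a radial
weight. -/
lemma integral_mul_norm_of_homogeneous [Nontrivial V] {f : V → ℝ}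
    (hf : ∀ (r : ℝ) (x : V), 0 < r → f (r • x) = r * f x) (φ : ℝ → ℝ) :
    ∫ x, f x * φ ‖x‖ = (∫ ξ : sphere (0 : V) 1, f ξ ∂(volume : Measure V).toSphere) *
      ∫ r : Set.Ioi (0 : ℝ), (r : ℝ) * φ r ∂Measure.volumeIoiPow (Module.finrank ℝ V - 1) := by
  calc ∫ x, f x * φ ‖x‖
      = ∫ x : ({0}ᶜ : Set V), f x * φ ‖(x : V)‖ ∂((volume : Measure V).comap (↑)) := by
        rw [integral_subtype_comap (measurableSet_singleton _).compl fun x => f x * φ ‖x‖,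
          restrict_compl_singleton]
    _ = ∫ z : sphere (0 : V) 1 × Set.Ioi (0 : ℝ), f z.1 * ((z.2 : ℝ) * φ z.2)
          ∂((volume : Measure V).toSphere.prod
            (Measure.volumeIoiPow (Module.finrank ℝ V - 1))) := by
        rw [← (volume : Measure V).measurePreserving_homeomorphUnitSphereProd.integral_comp
          (Homeomorph.measurableEmbedding _)]
        refine integral_congr_ae (Filter.Eventually.of_forall fun x => ?_)
        have hx : 0 < ‖(x : V)‖ := norm_pos_iff.2 x.2
        have h1 : f (x : V) = ‖(x : V)‖ * f (homeomorphUnitSphereProd V x).1 := by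
          rw [← hf _ _ hx, homeomorphUnitSphereProd_apply_fst_coe, smul_smul,
            mul_inv_cancel₀ hx.ne', one_smul]
        simp only [homeomorphUnitSphereProd_apply_snd_coe]
        rw [h1]
        ring
    _ = _ := integral_prod_mul (fun ξ : sphere (0 : V) 1 => f ξ)
      (fun r : Set.Ioi (0 : ℝ) => (r : ℝ) * φ r)

lemma integral_stdGaussian_of_homogeneous [Nontrivial V] {f : V → ℝ}
    (hf : ∀ (r : ℝ) (x : V), 0 < r → f (r • x) = r * f x) :
    (∫ x, f x ∂stdGaussian V) * (volume : Measure V).toSphere.real Set.univ =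
      (∫ x, ‖x‖ ∂stdGaussian V) *
        ∫ ξ : sphere (0 : V) 1, f ξ ∂(volume : Measure V).toSphere := by
  have h : ∀ g : V → ℝ, ∫ x, g x ∂stdGaussian V =
      ∫ x, g x * ((2 * Real.pi) ^ (-(Module.finrank ℝ V : ℝ) / 2) * Real.exp (-‖x‖ ^ 2 / 2)) := by
    intro g
    rw [stdGaussian_eq_withDensity, integral_withDensity_eq_integral_toReal_smul (by fun_prop)
      (Filter.Eventually.of_forall fun x => ENNReal.ofReal_lt_top)]
    refine integral_congr_ae (Filter.Eventually.of_forall fun x => ?_)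
    simp only
    rw [ENNReal.toReal_ofReal (by positivity), smul_eq_mul, mul_comm]
  rw [h, h, integral_mul_norm_of_homogeneous hf
      (fun r => (2 * Real.pi) ^ (-(Module.finrank ℝ V : ℝ) / 2) * Real.exp (-r ^ 2 / 2)),
    integral_mul_norm_of_homogeneous (f := fun x : V => ‖x‖)
      (fun r x hr => by rw [norm_smul, Real.norm_of_nonneg hr.le])
      (fun r => (2 * Real.pi) ^ (-(Module.finrank ℝ V : ℝ) / 2) * Real.exp (-r ^ 2 / 2))]
  have h1 : ∫ ξ : sphere (0 : V) 1, ‖(ξ : V)‖ ∂(volume : Measure V).toSphere =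
      (volume : Measure V).toSphere.real Set.univ := by
    simp
  rw [h1]
  ring

/-- Polar coordinates for the gauge under the standard Gaussian measure. -/
lemma integral_gauge_stdGaussian {n : ℕ} (hn : 0 < n) (K : Set (EuclideanSpace ℝ (Fin n))) :
    ∫ x, gauge K x ∂stdGaussian (EuclideanSpace ℝ (Fin n)) =
      (∫ x, ‖x‖ ∂stdGaussian (EuclideanSpace ℝ (Fin n))) * meanGauge K := by
  have : Nonempty (Fin n) := ⟨⟨0, hn⟩⟩
  have h := integral_stdGaussian_of_homogeneous (V := EuclideanSpace ℝ (Fin n)) (f := gauge K)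
    (fun r x hr => by rw [gauge_smul_of_nonneg hr.le, smul_eq_mul])
  have hpos : (volume : Measure (EuclideanSpace ℝ (Fin n))).toSphere.real Set.univ ≠ 0 := by
    rw [measureReal_ne_zero_iff, Measure.measure_univ_ne_zero]
    exact Measure.toSphere_ne_zero _
  rw [meanGauge, sphereProb, integral_smul_measure, ENNReal.toReal_inv, smul_eq_mul,
    mul_left_comm, ← h, ← measureReal_def]
  field_simp

lemma map_inner_stdGaussian {u : V} (hu : ‖u‖ = 1) :
    (stdGaussian V).map (fun x => ⟪u, x⟫) = gaussianReal 0 1 := by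
  have h := IsGaussian.map_eq_gaussianReal (μ := stdGaussian V) (innerSL ℝ u)
  rw [integral_strongDual_stdGaussian, variance_dual_stdGaussian] at h
  simpa [hu] using h

lemma integral_inner_sq_stdGaussian (v : V) : ∫ x, ⟪v, x⟫ ^ 2 ∂stdGaussian V = ‖v‖ ^ 2 := by
  have h := variance_dual_stdGaussian (innerSL ℝ v)
  rw [variance_eq_integral (by fun_prop), integral_strongDual_stdGaussian] at h
  simpa using h

lemma integrable_inner_sq_stdGaussian (v : V) :
    Integrable (fun x => ⟪v, x⟫ ^ 2) (stdGaussian V) := by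
  have h := (IsGaussian.memLp_two_id (μ := stdGaussian V)).continuousLinearMap_comp (innerSL ℝ v)
  simpa using h.integrable_sq

lemma integrable_norm_stdGaussian : Integrable (fun x : V => ‖x‖) (stdGaussian V) :=
  (IsGaussian.integrable_id (μ := stdGaussian V)).norm

/-- The coordinates of a Gaussian vector along orthonormal directions are independent standard
normal variables. -/
lemma map_orthonormal_stdGaussian {ι : Type*} [Fintype ι] {z : ι → V} (hz : Orthonormal ℝ z) :
    (stdGaussian V).map (fun x i => ⟪z i, x⟫) = Measure.pi fun _ : ι => gaussianReal 0 1 := by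
  have hm : Measurable fun x : V => WithLp.toLp 2 fun i : ι => ⟪z i, x⟫ := by fun_prop
  have h : (stdGaussian V).map (fun x => WithLp.toLp 2 fun i : ι => ⟪z i, x⟫) =
      stdGaussian (EuclideanSpace ℝ ι) := by
    have : IsProbabilityMeasure
        ((stdGaussian V).map (fun x => WithLp.toLp 2 fun i : ι => ⟪z i, x⟫)) :=
      Measure.isProbabilityMeasure_map hm.aemeasurable
    refine Measure.ext_of_charFun ?_
    ext t
    rw [charFun_apply, integral_map hm.aemeasurable (by fun_prop), charFun_stdGaussian]
    have e : ∀ x : V, ⟪(WithLp.toLp 2 fun i : ι => ⟪z i, x⟫ : EuclideanSpace ℝ ι), t⟫ =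
        ⟪x, ∑ i, t i • z i⟫ := fun x => by
      rw [PiLp.inner_apply, inner_sum]
      refine Finset.sum_congr rfl fun i _ => ?_
      simp [real_inner_smul_right, real_inner_comm]
    simp_rw [e]
    rw [← charFun_apply, charFun_stdGaussian]
    congr 4
    norm_cast
    rw [← sq_eq_sq₀ (norm_nonneg _) (norm_nonneg _),
      EuclideanSpace.real_norm_sq_eq, ← real_inner_self_eq_norm_sq, hz.inner_sum]
    simp [sq]
  rw [← map_pi_eq_stdGaussian] at h
  have h2 := congrArg (Measure.map (WithLp.ofLp : EuclideanSpace ℝ ι → ι → ℝ)) h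
  rw [Measure.map_map (by fun_prop) hm, Measure.map_map (by fun_prop) (by fun_prop)] at h2
  simpa [Function.comp_def] using h2

end Gaussian

/-! ### Gaussian means of norms and of maxima of linear functionals -/

section GaussianEstimates

variable {V : Type*} [NormedAddCommGroup V] [InnerProductSpace ℝ V] [FiniteDimensional ℝ V]
  [MeasurableSpace V] [BorelSpace V]

/-- The first absolute moment of a standard normal variable. -/
noncomputable def gaussianAbsMean : ℝ := ∫ x, |x| ∂gaussianReal 0 1

lemma integrable_abs_gaussianReal : Integrable (fun x : ℝ => |x|) (gaussianReal 0 1) :=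
  (IsGaussian.integrable_id (μ := gaussianReal 0 1)).abs

lemma gaussianAbsMean_pos : 0 < gaussianAbsMean := by
  rw [gaussianAbsMean, integral_pos_iff_support_of_nonneg (fun x => abs_nonneg x)
    integrable_abs_gaussianReal]
  have : Function.support (fun x : ℝ => |x|) = {0}ᶜ := by
    ext x
    simp
  rw [this, prob_compl_eq_one_sub (measurableSet_singleton 0)]
  have := nullSingletonClass_gaussianReal (μ := 0) (v := 1) one_ne_zero
  simp

lemma integral_abs_inner_stdGaussian {u : V} (hu : ‖u‖ = 1) :
    ∫ x, |⟪u, x⟫| ∂stdGaussian V = gaussianAbsMean := by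
  rw [gaussianAbsMean, ← map_inner_stdGaussian hu, integral_map (by fun_prop) (by fun_prop)]

lemma integrable_inner_stdGaussian (u : V) : Integrable (fun x => ⟪u, x⟫) (stdGaussian V) :=
  (IsGaussian.integrable_id (μ := stdGaussian V)).const_inner u

lemma integral_norm_stdGaussian_le :
    ∫ x, ‖x‖ ∂stdGaussian V ≤ √(Module.finrank ℝ V) := by
  set d := Module.finrank ℝ V with hd
  let b := stdOrthonormalBasis ℝ V
  have hsq : ∀ x : V, ‖x‖ ^ 2 = ∑ i, ⟪b i, x⟫ ^ 2 := fun x => (b.sum_sq_inner_right x).symm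
  have hi : Integrable (fun x : V => ‖x‖ ^ 2) (stdGaussian V) := by
    simp_rw [hsq]
    exact integrable_finsetSum _ fun i _ => integrable_inner_sq_stdGaussian _
  have hint : ∫ x, ‖x‖ ^ 2 ∂stdGaussian V = d := by
    simp_rw [hsq]
    rw [integral_finsetSum _ fun i _ => integrable_inner_sq_stdGaussian _]
    simp [integral_inner_sq_stdGaussian, hd]
  have hJ : (∫ x, ‖x‖ ∂stdGaussian V) ^ 2 ≤ d := by
    have h := variance_nonneg (fun x : V => ‖x‖) (stdGaussian V)
    have hmem : MemLp (fun x : V => ‖x‖) 2 (stdGaussian V) :=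
      (IsGaussian.memLp_two_id (μ := stdGaussian V)).norm
    rw [variance_eq_sub hmem] at h
    have h2 : ∫ x, ((fun x : V => ‖x‖) ^ 2) x ∂stdGaussian V = d := hint
    rw [h2] at h
    linarith
  exact Real.le_sqrt_of_sq_le hJ

/-- By Cauchy–Schwarz the norm is at least the `ℓ¹` norm of the coordinates divided by `√d`. -/
lemma le_integral_norm_stdGaussian :
    gaussianAbsMean * √(Module.finrank ℝ V) ≤ ∫ x, ‖x‖ ∂stdGaussian V := by
  set d := Module.finrank ℝ V with hd
  rcases Nat.eq_zero_or_pos d with h0 | hpos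
  · rw [h0]
    simpa using integral_nonneg fun x : V => norm_nonneg x
  let b := stdOrthonormalBasis ℝ V
  have hpt : ∀ x : V, ∑ i, |⟪b i, x⟫| ≤ √d * ‖x‖ := fun x => by
    have h := sq_sum_le_card_mul_sum_sq (s := Finset.univ) (f := fun i => |⟪b i, x⟫|)
    simp only [sq_abs, b.sum_sq_inner_right, Finset.card_univ, Fintype.card_fin] at h
    have h3 := Real.sqrt_le_sqrt h
    rwa [Real.sqrt_sq (Finset.sum_nonneg fun i _ => abs_nonneg _), Real.sqrt_mul (by positivity),
      Real.sqrt_sq (norm_nonneg x)] at h3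
  have h := integral_mono (μ := stdGaussian V)
    (integrable_finsetSum _ fun i _ => (integrable_inner_stdGaussian (b i)).abs)
    (integrable_norm_stdGaussian.const_mul (√d)) hpt
  rw [integral_finsetSum _ fun i _ => (integrable_inner_stdGaussian (b i)).abs,
    integral_const_mul] at h
  simp only [integral_abs_inner_stdGaussian (b.norm_eq_one _), Finset.sum_const, Finset.card_univ,
    Fintype.card_fin, nsmul_eq_mul] at h
  have hs : 0 < √(d : ℝ) := Real.sqrt_pos.2 (by exact_mod_cast hpos)
  have hss : √(d : ℝ) * √d = d := Real.mul_self_sqrt (by positivity)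
  have h' : √(d : ℝ) * (√d * gaussianAbsMean) ≤ √d * ∫ x, ‖x‖ ∂stdGaussian V := by
    rwa [← mul_assoc, hss]
  have := le_of_mul_le_mul_left h' hs
  linarith

lemma le_gaussianReal_Ici {t : ℝ} (ht : 0 ≤ t) :
    (√(2 * Real.pi))⁻¹ * Real.exp (-(t + 1) ^ 2 / 2) ≤ (gaussianReal 0 1).real (Set.Ici t) := by
  have h : ENNReal.ofReal ((√(2 * Real.pi))⁻¹ * Real.exp (-(t + 1) ^ 2 / 2)) ≤
      gaussianReal 0 1 (Set.Ici t) := by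
    calc ENNReal.ofReal ((√(2 * Real.pi))⁻¹ * Real.exp (-(t + 1) ^ 2 / 2))
        = ∫⁻ _ in Set.Icc t (t + 1),
            ENNReal.ofReal ((√(2 * Real.pi))⁻¹ * Real.exp (-(t + 1) ^ 2 / 2)) := by
          simp
      _ ≤ ∫⁻ x in Set.Icc t (t + 1), gaussianPDF 0 1 x := by
          refine setLIntegral_mono' measurableSet_Icc fun x hx => ?_
          rw [gaussianPDF]
          refine ENNReal.ofReal_le_ofReal ?_
          rw [gaussianPDFReal]
          simp only [NNReal.coe_one, mul_one, sub_zero]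
          gcongr
          · exact ht.trans hx.1
          · exact hx.2
      _ = gaussianReal 0 1 (Set.Icc t (t + 1)) := by rw [gaussianReal_apply 0 one_ne_zero]
      _ ≤ gaussianReal 0 1 (Set.Ici t) := measure_mono fun x hx => hx.1
  exact (ENNReal.ofReal_le_iff_le_toReal (measure_ne_top _ _)).1 h

lemma stdGaussian_real_exists_le {k : ℕ} {z : Fin k → V} (hz : Orthonormal ℝ z) (t : ℝ) :
    (stdGaussian V).real {x | ∃ i, t ≤ ⟪z i, x⟫} =
      1 - (1 - (gaussianReal 0 1).real (Set.Ici t)) ^ k := by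
  have hm : MeasurableSet {x : V | ∀ i, ⟪z i, x⟫ < t} := by
    simp only [Set.ofPred_forall]
    exact MeasurableSet.iInter fun i => measurableSet_lt (by fun_prop) measurable_const
  have hc : {x : V | ∃ i, t ≤ ⟪z i, x⟫} = {x : V | ∀ i, ⟪z i, x⟫ < t}ᶜ := by
    ext x
    simp
  have hI : (gaussianReal 0 1).real (Set.Iio t) = 1 - (gaussianReal 0 1).real (Set.Ici t) := by
    rw [← Set.compl_Ici, probReal_compl_eq_one_sub measurableSet_Ici]
  have hpre : {x : V | ∀ i, ⟪z i, x⟫ < t} =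
      (fun x i => ⟪z i, x⟫) ⁻¹' (Set.univ.pi fun _ : Fin k => Set.Iio t) := by
    ext x
    simp
  rw [hc, probReal_compl_eq_one_sub hm, hpre, measureReal_def, ← Measure.map_apply (by fun_prop)
    (MeasurableSet.univ_pi fun _ => measurableSet_Iio), map_orthonormal_stdGaussian hz,
    Measure.pi_pi, ← hI]
  simp [measureReal_def]

/-- A function dominating `k` linear functionals whose gradients are close to an orthonormal system
has large Gaussian mean, because one of `k` independent normal variables is likely to exceed `t`. -/
lemma le_integral_of_almost_orthonormal {f : V → ℝ} (hf : Integrable f (stdGaussian V))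
    (hf0 : ∀ x, 0 ≤ f x) {k : ℕ} {u z : Fin k → V} (hz : Orthonormal ℝ z)
    (huf : ∀ i x, ⟪u i, x⟫ ≤ f x) (huz : ∑ i, ‖u i - z i‖ ^ 2 ≤ 2) {t : ℝ} (ht : 0 ≤ t)
    (hk : √(2 * Real.pi) * Real.exp ((t + 1) ^ 2 / 2) ≤ k) :
    t / 2 - 3 / 2 ≤ ∫ x, f x ∂stdGaussian V := by
  -- `W` bounds every error `|⟪u i - z i, x⟫|`, because `2 |a| ≤ 1 + a ^ 2`
  set W : V → ℝ := fun x => (1 + ∑ i, ⟪u i - z i, x⟫ ^ 2) / 2 with hW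
  have hWi : Integrable W (stdGaussian V) :=
    ((integrable_const _).add (integrable_finsetSum _ fun i _ =>
      integrable_inner_sq_stdGaussian (u i - z i))).div_const 2
  have hWle : ∫ x, W x ∂stdGaussian V ≤ 3 / 2 := by
    rw [hW, integral_div, integral_add (integrable_const _) (integrable_finsetSum _ fun i _ =>
      integrable_inner_sq_stdGaussian (u i - z i)),
      integral_finsetSum _ fun i _ => integrable_inner_sq_stdGaussian (u i - z i)]
    simp only [integral_inner_sq_stdGaussian, integral_const, probReal_univ, smul_eq_mul]
    linarith
  have hm : MeasurableSet {x : V | ∃ i, t ≤ ⟪z i, x⟫} := by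
    simp only [Set.ofPred_exists]
    exact MeasurableSet.iUnion fun i => measurableSet_le measurable_const (by fun_prop)
  have hpt : ∀ x, Set.indicator {x : V | ∃ i, t ≤ ⟪z i, x⟫} (fun _ => t) x ≤ f x + W x := by
    intro x
    have hW0 : 0 ≤ W x := by
      have : 0 ≤ ∑ i, ⟪u i - z i, x⟫ ^ 2 := Finset.sum_nonneg fun i _ => sq_nonneg _
      simp only [hW]
      linarith
    by_cases hx : x ∈ {x : V | ∃ i, t ≤ ⟪z i, x⟫}
    · rw [Set.indicator_of_mem hx]
      obtain ⟨i, hi⟩ := hx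
      have h1 := huf i x
      have h2 : ⟪u i - z i, x⟫ ^ 2 ≤ ∑ i, ⟪u i - z i, x⟫ ^ 2 :=
        Finset.single_le_sum (f := fun i => ⟪u i - z i, x⟫ ^ 2) (fun i _ => sq_nonneg _)
          (Finset.mem_univ i)
      have h3 := sq_nonneg (⟪u i - z i, x⟫ + 1)
      have h4 : ⟪u i - z i, x⟫ = ⟪u i, x⟫ - ⟪z i, x⟫ := inner_sub_left _ _ _
      simp only [hW]
      nlinarith
    · rw [Set.indicator_of_notMem hx]
      linarith [hf0 x]
  have hint := integral_mono ((integrable_const t).indicator hm) (hf.add hWi) hpt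
  rw [integral_indicator_const _ hm, smul_eq_mul] at hint
  have hsum : ∫ x, (f + W) x ∂stdGaussian V = ∫ x, f x ∂stdGaussian V + ∫ x, W x ∂stdGaussian V :=
    integral_add hf hWi
  have hprob : 1 / 2 ≤ (stdGaussian V).real {x | ∃ i, t ≤ ⟪z i, x⟫} := by
    rw [stdGaussian_real_exists_le hz]
    set p := (gaussianReal 0 1).real (Set.Ici t)
    have hp1 : p ≤ 1 := measureReal_le_one
    -- `k` is so large that the expected number of exceedances of `t` is at least `1`
    have hpk : 1 ≤ p * k := by
      have h1 := le_gaussianReal_Ici ht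
      have h2 : (√(2 * Real.pi))⁻¹ * Real.exp (-(t + 1) ^ 2 / 2) *
          (√(2 * Real.pi) * Real.exp ((t + 1) ^ 2 / 2)) = 1 := by
        have hs : √(2 * Real.pi) ≠ 0 := by positivity
        rw [mul_mul_mul_comm, inv_mul_cancel₀ hs, one_mul, ← Real.exp_add, neg_div,
          neg_add_cancel, Real.exp_zero]
      rw [← h2]
      exact mul_le_mul h1 hk (by positivity) measureReal_nonneg
    have h3 : (1 - p) ^ k ≤ Real.exp (-1) := by
      calc (1 - p) ^ k ≤ Real.exp (-p) ^ k :=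
            pow_le_pow_left₀ (by linarith) (Real.one_sub_le_exp_neg p) k
        _ = Real.exp (-(p * k)) := by rw [← Real.exp_nat_mul]; ring_nf
        _ ≤ Real.exp (-1) := Real.exp_le_exp.2 (by linarith)
    have h4 : Real.exp (-1) ≤ 1 / 2 := by
      rw [Real.exp_neg, inv_le_comm₀ (Real.exp_pos 1) (by norm_num)]
      have := Real.add_one_le_exp 1
      norm_num at this ⊢
      linarith
    linarith
  have h5 : 1 / 2 * t ≤ (stdGaussian V).real {x | ∃ i, t ≤ ⟪z i, x⟫} * t :=
    mul_le_mul_of_nonneg_right hprob ht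
  change _ ≤ ∫ x, (f + W) x ∂stdGaussian V at hint
  linarith

/-- A nonnegative function dominating `⟪u, ·⟫` dominates its positive part. -/
lemma le_integral_of_inner_le {f : V → ℝ} (hf : Integrable f (stdGaussian V))
    (hf0 : ∀ x, 0 ≤ f x) {u : V} (hu : ‖u‖ = 1) (huf : ∀ x, ⟪u, x⟫ ≤ f x) :
    gaussianAbsMean / 2 ≤ ∫ x, f x ∂stdGaussian V := by
  have hpt : ∀ x, (|⟪u, x⟫| + ⟪u, x⟫) / 2 ≤ f x := fun x => by
    rcases abs_cases ⟪u, x⟫ with h | h <;> linarith [h.1, huf x, hf0 x]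
  have hi := integrable_inner_stdGaussian u
  have h := integral_mono ((hi.abs.add hi).div_const 2) hf hpt
  have h0 : ∫ x, ⟪u, x⟫ ∂stdGaussian V = 0 := by
    simpa using integral_strongDual_stdGaussian (innerSL ℝ u)
  have h1 : ∫ x, (|⟪u, x⟫| + ⟪u, x⟫) / 2 ∂stdGaussian V = gaussianAbsMean / 2 := by
    rw [integral_div, integral_add hi.abs hi, h0, integral_abs_inner_stdGaussian hu, add_zero]
  exact h1.symm.le.trans h

end GaussianEstimates

/-! ### Contact points of a body in John's position -/

section ContactPoints

lemma inner_le_gauge_of_forall_le_one {V : Type*} [NormedAddCommGroup V] [InnerProductSpace ℝ V]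
    {K : Set V} (h0 : K ∈ nhds 0) {u : V} (hu : ∀ y ∈ K, ⟪u, y⟫ ≤ 1) (x : V) :
    ⟪u, x⟫ ≤ gauge K x := by
  refine le_of_forall_gt fun r hr => ?_
  obtain ⟨s, hs0, hsr, hx⟩ := exists_lt_of_gauge_lt (absorbent_nhds_zero h0) hr
  obtain ⟨y, hy, rfl⟩ := hx
  change ⟪u, s • y⟫ < r
  rw [real_inner_smul_right]
  nlinarith [hu y hy]

/-- At a point where the unit sphere touches the boundary of `K`, the supporting hyperplane of `K`
is the tangent hyperplane of the ball. -/
lemma Convex.inner_le_one_of_mem_frontier {V : Type*} [NormedAddCommGroup V]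
    [InnerProductSpace ℝ V] [FiniteDimensional ℝ V] {K : Set V} (hK : Convex ℝ K)
    (hB : closedBall 0 1 ⊆ K) {u : V} (hu : ‖u‖ = 1) (huK : u ∈ frontier K) :
    ∀ y ∈ K, ⟪u, y⟫ ≤ 1 := by
  have hint : (interior K).Nonempty :=
    ⟨0, mem_interior_iff_mem_nhds.2 (Filter.mem_of_superset (closedBall_mem_nhds 0 one_pos) hB)⟩
  obtain ⟨v, hv0, hv⟩ := hK.exists_inner_le_of_mem_frontier hint huK
  have hvn : 0 < ‖v‖ := norm_pos_iff.2 hv0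
  have h1 : ‖v‖ ≤ ⟪v, u⟫ := by
    have h := hv (‖v‖⁻¹ • v) (hB (by simp [norm_smul, hvn.ne']))
    rw [real_inner_smul_right, real_inner_self_eq_norm_sq] at h
    calc ‖v‖ = ‖v‖⁻¹ * ‖v‖ ^ 2 := by field_simp
      _ ≤ _ := h
  have h2 : ⟪v, u⟫ = ‖v‖ * ‖u‖ := by
    refine le_antisymm (real_inner_le_norm v u) ?_
    rwa [hu, mul_one]
  have h3 := (inner_eq_norm_mul_iff_real).1 h2
  rw [hu, one_smul] at h3
  intro y hy
  have h4 := hv y hy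
  have h5 : ⟪v, y⟫ = ‖v‖ * ⟪u, y⟫ := by
    conv_lhs => rw [h3]
    rw [real_inner_smul_left]
  rw [h2, hu, h5] at h4
  exact le_of_mul_le_mul_left h4 hvn

/-- Dvoretzky–Rogers: a body in John's position has a contact point whose projection onto any given
coordinate subspace of an orthonormal basis has at most the average squared length. Otherwise
shrinking the ball along this subspace and expanding it along the orthogonal complement gives a
larger inscribed ellipsoid. -/
lemma IsJohnPosition.exists_contact {n : ℕ} {K : Set (EuclideanSpace ℝ (Fin n))}
    (hK : IsJohnPosition K) (hn : 0 < n) {ι : Type*} [Fintype ι]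
    (b : OrthonormalBasis ι ℝ (EuclideanSpace ℝ (Fin n))) (s : Finset ι) :
    ∃ x, ‖x‖ = 1 ∧ x ∈ frontier K ∧ ∑ i ∈ s, ⟪b i, x⟫ ^ 2 ≤ s.card / n := by
  classical
  by_contra hno
  push Not at hno
  obtain ⟨⟨hconv, hcpt, -⟩, hB, hmax⟩ := hK
  have hn' : (0 : ℝ) < n := by exact_mod_cast hn
  have hcard : Fintype.card ι = n := by
    have := Module.finrank_eq_card_basis b.toBasis
    simpa using this.symm
  set f : EuclideanSpace ℝ (Fin n) → ℝ := fun x => ∑ i ∈ s, ⟪b i, x⟫ ^ 2 with hf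
  have hfc : Continuous f := by fun_prop
  set τ : ℝ := s.card / n with hτ
  have hτ0 : 0 ≤ τ := by positivity
  have hτ1 : τ ≤ 1 := by
    rw [hτ, div_le_one hn']
    have := s.card_le_univ
    rw [hcard] at this
    exact_mod_cast this
  have hsph : IsCompact (sphere (0 : EuclideanSpace ℝ (Fin n)) 1) := isCompact_sphere 0 1
  obtain ⟨δ, hδ0, hδ1, hδ⟩ : ∃ δ : ℝ, 0 < δ ∧ δ ≤ 1 ∧
      ∀ x, ‖x‖ = 1 → x ∈ frontier K → τ + 2 * δ < f x := by
    have hC : IsCompact (sphere (0 : EuclideanSpace ℝ (Fin n)) 1 ∩ frontier K) :=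
      hsph.inter_right isClosed_frontier
    rcases (sphere (0 : EuclideanSpace ℝ (Fin n)) 1 ∩ frontier K).eq_empty_or_nonempty with
      hemp | hne
    · refine ⟨1, one_pos, le_rfl, fun x hx hxK => ?_⟩
      have : x ∈ sphere (0 : EuclideanSpace ℝ (Fin n)) 1 ∩ frontier K := ⟨by simpa using hx, hxK⟩
      rw [hemp] at this
      exact this.elim
    · obtain ⟨x₀, ⟨hx₀, hx₀K⟩, hmin⟩ := hC.exists_isMinOn hne hfc.continuousOn
      have h := hno x₀ (by simpa using hx₀) hx₀K
      refine ⟨min 1 ((f x₀ - τ) / 4), lt_min one_pos (by linarith), min_le_left _ _,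
        fun x hx hxK => ?_⟩
      have h1 : f x₀ ≤ f x := hmin ⟨by simpa using hx, hxK⟩
      have h2 := min_le_right 1 ((f x₀ - τ) / 4)
      linarith
  have hD : IsCompact {x ∈ sphere (0 : EuclideanSpace ℝ (Fin n)) 1 | f x ≤ τ + 2 * δ} :=
    hsph.inter_right (isClosed_le hfc continuous_const)
  have hDK : {x ∈ sphere (0 : EuclideanSpace ℝ (Fin n)) 1 | f x ≤ τ + 2 * δ} ⊆ interior K := by
    rintro x ⟨hx, hfx⟩
    by_contra hxi
    have hxK : x ∈ frontier K := ⟨subset_closure (hB (sphere_subset_closedBall hx)), hxi⟩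
    exact absurd hfx (not_le.2 (hδ x (by simpa using hx) hxK))
  obtain ⟨ρ, hρ, hthick⟩ := hD.exists_thickening_subset_open isOpen_interior hDK
  set ε : ℝ := min (1 / 4) (min (ρ / 8) (δ / 8)) with hε
  have hε0 : 0 < ε := by positivity
  have hε1 : ε ≤ 1 / 4 := min_le_left _ _
  have hε2 : ε ≤ ρ / 8 := (min_le_right _ _).trans (min_le_left _ _)
  have hε3 : ε ≤ δ / 8 := (min_le_right _ _).trans (min_le_right _ _)
  -- The exponents `ε * h i` have positive sum, so the diagonal map `T` below increases the volume.
  -- On the unit sphere `∑ h i * ⟪b i, x⟫ ^ 2 = τ + δ - f x`, so to first order `T` shortens the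
  -- vectors with `f x > τ + 2 * δ`; the other ones lie well inside `K`.
  set h : ι → ℝ := fun i => τ + δ - if i ∈ s then 1 else 0 with hh
  have hh2 : ∀ i, |h i| ≤ 2 := fun i => by
    simp only [hh]
    rw [abs_le]
    split_ifs <;> constructor <;> linarith
  have hεh : ∀ i, |ε * h i| ≤ 2 * ε := fun i => by
    rw [abs_mul, abs_of_pos hε0]
    nlinarith [hh2 i]
  have hεh1 : ∀ i, |ε * h i| ≤ 1 := fun i => (hεh i).trans (by linarith)
  have hsumh : ∑ i, h i = n * δ := by
    simp only [hh, Finset.sum_sub_distrib, Finset.sum_const, Finset.card_univ, hcard, nsmul_eq_mul,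
      Finset.sum_ite_mem, Finset.univ_inter, hτ]
    field_simp
    ring
  set T : EuclideanSpace ℝ (Fin n) →ₗ[ℝ]
      EuclideanSpace ℝ (Fin n) := Matrix.toLin b.toBasis b.toBasis
    (Matrix.diagonal fun i => Real.exp (ε * h i)) with hT
  have hdet : LinearMap.det T = Real.exp (ε * (n * δ)) := by
    rw [hT, LinearMap.det_toLin, Matrix.det_diagonal, ← Real.exp_sum, ← Finset.mul_sum, hsumh]
  have hcoord : ∀ x i, ⟪b i, T x⟫ = Real.exp (ε * h i) * ⟪b i, x⟫ := fun x i => by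
    have h1 := congrFun (Matrix.repr_toLin b.toBasis b.toBasis
      (Matrix.diagonal fun i => Real.exp (ε * h i)) x) i
    rw [Matrix.mulVec_diagonal] at h1
    simpa [OrthonormalBasis.repr_apply_apply] using h1
  have hsph_sub : ∀ x, ‖x‖ = 1 → T x ∈ K := by
    intro x hx
    have hx2 : ∑ i, ⟪b i, x⟫ ^ 2 = 1 := by rw [b.sum_sq_inner_right, hx, one_pow]
    by_cases hfx : f x ≤ τ + 2 * δ
    · refine interior_subset (hthick (mem_thickening_iff.2 ⟨x, ⟨by simpa using hx, hfx⟩, ?_⟩))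
      rw [dist_eq_norm]
      have h1 : ‖T x - x‖ ^ 2 ≤ (4 * ε) ^ 2 := by
        rw [← b.sum_sq_inner_right, ← mul_one ((4 * ε) ^ 2), ← hx2, Finset.mul_sum]
        refine Finset.sum_le_sum fun i _ => ?_
        rw [inner_sub_right, hcoord, ← sub_one_mul, mul_pow]
        refine mul_le_mul_of_nonneg_right ?_ (sq_nonneg _)
        rw [← sq_abs]
        refine pow_le_pow_left₀ (abs_nonneg _) ?_ 2
        have := Real.abs_exp_sub_one_le (hεh1 i)
        linarith [hεh i]
      have h2 := abs_le_of_sq_le_sq h1 (by positivity)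
      rw [abs_of_nonneg (norm_nonneg _)] at h2
      linarith
    · push Not at hfx
      refine hB ?_
      rw [mem_closedBall_zero_iff]
      have h1 : ‖T x‖ ^ 2 ≤ 1 ^ 2 := by
        have h2 : ∀ i, ⟪b i, T x⟫ ^ 2 ≤ (1 + 2 * ε * h i + 16 * ε ^ 2) * ⟪b i, x⟫ ^ 2 := fun i => by
          rw [hcoord, mul_pow, ← Real.exp_nat_mul]
          refine mul_le_mul_of_nonneg_right ?_ (sq_nonneg _)
          have hle : |((2 : ℕ) : ℝ) * (ε * h i)| ≤ 4 * ε := by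
            rw [abs_mul, Nat.abs_cast, Nat.cast_ofNat]
            linarith [hεh i]
          have h3 := (abs_le.1 (Real.abs_exp_sub_one_sub_id_le (hle.trans (by linarith)))).2
          have h4 : (((2 : ℕ) : ℝ) * (ε * h i)) ^ 2 ≤ (4 * ε) ^ 2 := by
            rw [← sq_abs]
            exact pow_le_pow_left₀ (abs_nonneg _) hle 2
          push_cast at h3 h4 ⊢
          linarith
        have h5 : ∑ i, h i * ⟪b i, x⟫ ^ 2 = τ + δ - f x := by
          simp only [hh, sub_mul, Finset.sum_sub_distrib, ← Finset.mul_sum, hx2, hf, ite_mul,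
            one_mul, zero_mul, Finset.sum_ite_mem, Finset.univ_inter, mul_one]
        have h6 : ∑ i, (1 + 2 * ε * h i + 16 * ε ^ 2) * ⟪b i, x⟫ ^ 2 =
            1 + 2 * ε * (τ + δ - f x) + 16 * ε ^ 2 := by
          rw [← h5, Finset.mul_sum]
          conv_rhs => rw [← mul_one (16 * ε ^ 2), ← hx2]
          rw [Finset.mul_sum, ← Finset.sum_add_distrib, ← Finset.sum_add_distrib]
          exact Finset.sum_congr rfl fun i _ => by ring
        rw [← b.sum_sq_inner_right]
        refine (Finset.sum_le_sum fun i _ => h2 i).trans ?_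
        rw [h6]
        nlinarith
      have h7 := abs_le_of_sq_le_sq h1 zero_le_one
      rwa [abs_of_nonneg (norm_nonneg _)] at h7
  have hT_sub : T '' closedBall 0 1 ⊆ K := by
    rintro _ ⟨x, hx, rfl⟩
    rw [mem_closedBall_zero_iff] at hx
    have h0K : (0 : EuclideanSpace ℝ (Fin n)) ∈ K := hB (by simp)
    rcases eq_or_ne x 0 with rfl | hx0
    · rwa [map_zero]
    have hxn : 0 < ‖x‖ := norm_pos_iff.2 hx0
    have h1 := hsph_sub (‖x‖⁻¹ • x) (by simp [norm_smul, hxn.ne'])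
    have h2 := hconv.smul_mem_of_zero_mem h0K h1 ⟨hxn.le, hx⟩
    rwa [map_smul, smul_smul, mul_inv_cancel₀ hxn.ne', one_smul] at h2
  have hdet1 : 1 < LinearMap.det T := by
    rw [hdet]
    exact Real.one_lt_exp_iff.2 (by positivity)
  have hell : IsEllipsoid (T '' closedBall 0 1) := by
    refine ⟨LinearMap.equivOfDetNeZero T (by linarith), 0, ?_⟩
    refine Set.image_congr fun x _ => ?_
    simp [LinearMap.equivOfDetNeZero]
  have hvol := hmax _ hell hT_sub
  rw [Measure.addHaar_image_linearMap, abs_of_pos (by linarith)] at hvol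
  have hpos : (volume (closedBall (0 : EuclideanSpace ℝ (Fin n)) 1)) ≠ 0 :=
    (measure_closedBall_pos _ _ one_pos).ne'
  have hfin : (volume (closedBall (0 : EuclideanSpace ℝ (Fin n)) 1)) ≠ ⊤ :=
    measure_closedBall_lt_top.ne
  have hlt : 1 * volume (closedBall (0 : EuclideanSpace ℝ (Fin n)) 1) <
      ENNReal.ofReal (LinearMap.det T) * volume (closedBall (0 : EuclideanSpace ℝ (Fin n)) 1) :=
    ENNReal.mul_lt_mul_left hpos hfin (by
      rw [← ENNReal.ofReal_one]
      exact (ENNReal.ofReal_lt_ofReal_iff (by linarith)).2 hdet1)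
  rw [one_mul] at hlt
  exact absurd hvol (not_le.2 hlt)

lemma IsJohnPosition.exists_contact_of_orthonormal {n : ℕ} {K : Set (EuclideanSpace ℝ (Fin n))}
    (hK : IsJohnPosition K) (hn : 0 < n) {k : ℕ} {z : Fin k → EuclideanSpace ℝ (Fin n)}
    (hz : Orthonormal ℝ z) :
    ∃ x, ‖x‖ = 1 ∧ x ∈ frontier K ∧ ∑ i, ⟪z i, x⟫ ^ 2 ≤ k / n := by
  classical
  obtain ⟨w, b, hzw, hb⟩ := hz.toSubtypeRange.exists_orthonormalBasis_extension
  let e : Fin k → w := fun i => ⟨z i, hzw ⟨i, rfl⟩⟩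
  have he : Function.Injective e := fun i j hij =>
    hz.linearIndependent.injective (congrArg Subtype.val hij)
  have hbe : ∀ i, b (e i) = z i := fun i => by rw [hb]
  obtain ⟨x, hx1, hxK, hx⟩ := hK.exists_contact hn b (Finset.univ.image e)
  refine ⟨x, hx1, hxK, ?_⟩
  rw [Finset.sum_image he.injOn, Finset.card_image_of_injective _ he] at hx
  simpa [hbe] using hx

/-- Greedy selection of contact points close to an orthonormal system: each new contact point is
almost orthogonal to the span of the previous vectors, and `z` is obtained from it by projecting
onto the orthogonal complement and normalizing. -/
lemma IsJohnPosition.exists_almost_orthonormal_contacts {n : ℕ}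
    {K : Set (EuclideanSpace ℝ (Fin n))} (hK : IsJohnPosition K) (k : ℕ) (hk : k ≤ n) :
    ∃ u z : Fin k → EuclideanSpace ℝ (Fin n), Orthonormal ℝ z ∧ ∀ i, ‖u i‖ = 1 ∧
      u i ∈ frontier K ∧ ‖u i - z i‖ ^ 2 ≤ 2 * i / n := by
  induction k with
  | zero => exact ⟨Fin.elim0, Fin.elim0, ⟨fun i => i.elim0, fun i => i.elim0⟩, fun i => i.elim0⟩
  | succ k ih =>
    obtain ⟨u, z, hz, huz⟩ := ih (by omega)
    have hn : 0 < n := by omega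
    have hn' : (0 : ℝ) < n := by exact_mod_cast hn
    obtain ⟨x, hx1, hxK, hx⟩ := hK.exists_contact_of_orthonormal hn hz
    set P := ∑ i, ⟪z i, x⟫ • z i with hP
    have hzP : ∀ i, ⟪z i, P⟫ = ⟪z i, x⟫ := fun i => hz.inner_right_fintype _ i
    set q := x - P with hq
    have hzq : ∀ i, ⟪z i, q⟫ = 0 := fun i => by rw [hq, inner_sub_right, hzP, sub_self]
    have hPq : ⟪P, q⟫ = 0 := by
      rw [hP, sum_inner]
      exact Finset.sum_eq_zero fun i _ => by rw [real_inner_smul_left, hzq, mul_zero]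
    have hxq : ⟪x, q⟫ = ‖q‖ ^ 2 := by
      rw [← real_inner_self_eq_norm_sq, ← sub_eq_zero, ← inner_sub_left,
        show x - q = P by rw [hq]; abel, hPq]
    have hqn : ‖q‖ ^ 2 = 1 - ∑ i, ⟪z i, x⟫ ^ 2 := by
      have : ⟪x, P⟫ = ∑ i, ⟪z i, x⟫ ^ 2 := by
        rw [hP, inner_sum]
        exact Finset.sum_congr rfl fun i _ => by rw [real_inner_smul_right, real_inner_comm, sq]
      rw [← hxq, hq, inner_sub_right, this, real_inner_self_eq_norm_sq, hx1, one_pow]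
    have hkn : (k : ℝ) / n < 1 := by
      rw [div_lt_one hn']
      exact_mod_cast hk
    have hsum0 : 0 ≤ ∑ i, ⟪z i, x⟫ ^ 2 := Finset.sum_nonneg fun i _ => sq_nonneg _
    have hq0 : 0 < ‖q‖ := by
      rcases (norm_nonneg q).eq_or_lt with h | h
      · rw [← h] at hqn
        norm_num at hqn
        linarith
      · exact h
    have hq1 : ‖q‖ ≤ 1 := by nlinarith
    have hzn : ‖‖q‖⁻¹ • q‖ = 1 := by simp [norm_smul, hq0.ne']
    refine ⟨Fin.snoc u x, Fin.snoc z (‖q‖⁻¹ • q), ?_, ?_⟩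
    · constructor
      · intro i
        refine Fin.lastCases ?_ (fun i => ?_) i
        · simpa using hzn
        · simpa using hz.1 i
      · intro i j
        refine Fin.lastCases ?_ (fun i => ?_) i <;> refine Fin.lastCases ?_ (fun j => ?_) j
        · intro h
          exact absurd rfl h
        · intro _
          rw [Fin.snoc_last, Fin.snoc_castSucc, real_inner_smul_left, real_inner_comm, hzq,
            mul_zero]
        · intro _
          simp [real_inner_smul_right, hzq]
        · intro h
          simpa using hz.2 (fun hij => h (by rw [hij]))
    · intro i
      refine Fin.lastCases ?_ (fun i => ?_) i
      · simp only [Fin.snoc_last, Fin.val_last]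
        refine ⟨hx1, hxK, ?_⟩
        have h1 : ⟪x, ‖q‖⁻¹ • q⟫ = ‖q‖ := by
          rw [real_inner_smul_right, hxq]
          field_simp
        rw [norm_sub_sq_real, hx1, hzn, h1, mul_div_assoc]
        nlinarith
      · simpa using huz i

end ContactPoints

/-! ### The mean gauge in John's position -/

section MeanGauge

lemma integrable_gauge_stdGaussian {V : Type*} [NormedAddCommGroup V] [InnerProductSpace ℝ V]
    [FiniteDimensional ℝ V] [MeasurableSpace V] [BorelSpace V] {K : Set V} (hK : Convex ℝ K)
    (hB : closedBall 0 1 ⊆ K) : Integrable (gauge K) (stdGaussian V) := by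
  have h0 : K ∈ nhds (0 : V) := Filter.mem_of_superset (closedBall_mem_nhds 0 one_pos) hB
  refine integrable_norm_stdGaussian.mono' (continuous_gauge hK h0).aestronglyMeasurable
    (Filter.Eventually.of_forall fun x => ?_)
  rw [Real.norm_of_nonneg (gauge_nonneg x)]
  simpa using mul_gauge_le_norm (x := x) (ball_subset_closedBall.trans hB)

lemma meanGauge_nonneg {n : ℕ} (K : Set (EuclideanSpace ℝ (Fin n))) : 0 ≤ meanGauge K :=
  integral_nonneg fun _ => gauge_nonneg _

/-- The number of contact points required by the choice of level `t = √(log n) / 2`. -/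
lemma sqrt_two_pi_mul_exp_le_sqrt {n : ℕ} (hn : 144 ≤ Real.log n) :
    √(2 * Real.pi) * Real.exp ((√(Real.log n) / 2 + 1) ^ 2 / 2) ≤ Nat.sqrt n := by
  set L := Real.log n with hL
  have hn0 : (0 : ℝ) < n := by
    rcases Nat.eq_zero_or_pos n with h | h
    · rw [hL, h] at hn
      norm_num at hn
    · exact_mod_cast h
  have hs : √L ^ 2 = L := Real.sq_sqrt (by linarith)
  have hs12 : 12 ≤ √L := Real.le_sqrt_of_sq_le (by linarith)
  have hsqn : √(n : ℝ) = Real.exp (L / 2) := by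
    rw [← Real.exp_log hn0, ← hL, Real.exp_half]
  have he : 2.7182818283 < Real.exp 1 := Real.exp_one_gt_d9
  have h1 : √(2 * Real.pi) ≤ Real.exp 1 := by
    rw [Real.sqrt_le_left (Real.exp_pos 1).le]
    nlinarith [Real.pi_lt_d2]
  have hk : √(n : ℝ) ≤ Nat.sqrt n + 1 := by
    refine Real.sqrt_le_left (by positivity) |>.2 ?_
    exact_mod_cast (Nat.lt_succ_sqrt' n).le
  have h2 : Real.exp (L / 2 - 1) * 2 ≤ √(n : ℝ) := by
    rw [hsqn, Real.exp_sub]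
    have := Real.exp_pos (L / 2)
    rw [div_mul_eq_mul_div, div_le_iff₀ (Real.exp_pos 1)]
    nlinarith
  have h3 : (1 : ℝ) ≤ Real.exp (L / 2 - 1) := Real.one_le_exp (by linarith)
  calc √(2 * Real.pi) * Real.exp ((√L / 2 + 1) ^ 2 / 2)
      ≤ Real.exp 1 * Real.exp ((√L / 2 + 1) ^ 2 / 2) := by gcongr
    _ = Real.exp (1 + (√L / 2 + 1) ^ 2 / 2) := by rw [Real.exp_add]
    _ ≤ Real.exp (L / 2 - 1) := Real.exp_le_exp.2 (by nlinarith)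
    _ ≤ Nat.sqrt n := by linarith

/-- The lower bound for `M(K)` in John's position, in Gaussian form. -/
theorem exists_sqrt_log_le_integral_gauge :
    ∃ c : ℝ, 0 < c ∧ ∀ n : ℕ, 2 ≤ n → ∀ K : Set (EuclideanSpace ℝ (Fin n)), IsJohnPosition K →
      c * √(Real.log n) ≤ ∫ x, gauge K x ∂stdGaussian (EuclideanSpace ℝ (Fin n)) := by
  have hα := gaussianAbsMean_pos
  refine ⟨min (1 / 8) (gaussianAbsMean / 24), by positivity, fun n hn K hK => ?_⟩
  have hconv := hK.isConvexBody.convex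
  have hB := hK.closedBall_subset
  have h0 : K ∈ nhds (0 : EuclideanSpace ℝ (Fin n)) :=
    Filter.mem_of_superset (closedBall_mem_nhds 0 one_pos) hB
  have hint := integrable_gauge_stdGaussian hconv hB
  have hdom : ∀ u : EuclideanSpace ℝ (Fin n), ‖u‖ = 1 → u ∈ frontier K → ∀ x,
      ⟪u, x⟫ ≤ gauge K x := fun u hu huK =>
    inner_le_gauge_of_forall_le_one h0 (hconv.inner_le_one_of_mem_frontier hB hu huK)
  set L := Real.log n with hL
  -- `√L ≥ 12` makes the main term `√L / 4` at least twice the error `3 / 2`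
  rcases lt_or_ge L 144 with hsmall | hlarge
  · obtain ⟨u, z, -, huz⟩ := hK.exists_almost_orthonormal_contacts 1 (by omega)
    have h1 := le_integral_of_inner_le hint (fun x => gauge_nonneg x) (huz 0).1
      (hdom _ (huz 0).1 (huz 0).2.1)
    have h2 : √L ≤ 12 := Real.sqrt_le_left (by norm_num) |>.2 (by linarith)
    have h3 := min_le_right (1 / 8) (gaussianAbsMean / 24)
    have h4 := mul_le_mul h3 h2 (Real.sqrt_nonneg L) (by positivity)
    linarith
  · have hs12 : 12 ≤ √L := Real.le_sqrt_of_sq_le (by linarith)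
    have hn' : (0 : ℝ) < n := by positivity
    have hkk : ((Nat.sqrt n : ℕ) : ℝ) ^ 2 ≤ n := by exact_mod_cast Nat.sqrt_le' n
    obtain ⟨u, z, hz, huz⟩ := hK.exists_almost_orthonormal_contacts (Nat.sqrt n)
      (Nat.sqrt_le_self n)
    have hsum : ∑ i, ‖u i - z i‖ ^ 2 ≤ 2 := by
      calc ∑ i, ‖u i - z i‖ ^ 2 ≤ ∑ _i : Fin (Nat.sqrt n), 2 * (Nat.sqrt n : ℝ) / n := by
            refine Finset.sum_le_sum fun i _ => (huz i).2.2.trans ?_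
            gcongr
            exact i.2.le
        _ = 2 * (Nat.sqrt n : ℝ) ^ 2 / n := by
            rw [Finset.sum_const, Finset.card_univ, Fintype.card_fin, nsmul_eq_mul]
            ring
        _ ≤ 2 := by
            rw [div_le_iff₀ hn']
            linarith
    have h1 := le_integral_of_almost_orthonormal hint (fun x => gauge_nonneg x) hz
      (fun i => hdom _ (huz i).1 (huz i).2.1) hsum (t := √L / 2) (by positivity)
      (sqrt_two_pi_mul_exp_le_sqrt hlarge)
    have h3 := mul_le_mul_of_nonneg_right (min_le_left (1 / 8) (gaussianAbsMean / 24))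
      (Real.sqrt_nonneg L)
    linarith

end MeanGauge

/-! ### The cube -/

section Cube

lemma unitCube_eq_preimage (n : ℕ) :
    unitCube n = WithLp.ofLp ⁻¹' (Set.univ.pi fun _ : Fin n => Set.Icc (-1 : ℝ) 1) := by
  ext x
  exact ⟨fun h i _ => h i, fun h i => h i trivial⟩

lemma volume_unitCube (n : ℕ) : volume (unitCube n) = 2 ^ n := by
  rw [unitCube_eq_preimage, (PiLp.volume_preserving_ofLp (Fin n)).measure_preimage
    (MeasurableSet.univ_pi fun _ => measurableSet_Icc).nullMeasurableSet, volume_pi_pi]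
  simp only [Real.volume_Icc, Finset.prod_const, Finset.card_univ, Fintype.card_fin]
  norm_num

lemma isClosed_unitCube (n : ℕ) : IsClosed (unitCube n) := by
  rw [unitCube_eq_preimage]
  exact (isClosed_set_pi fun _ _ => isClosed_Icc).preimage (by fun_prop)

lemma closedBall_subset_unitCube (n : ℕ) : closedBall 0 1 ⊆ unitCube n := by
  intro x hx i
  rw [mem_closedBall_zero_iff] at hx
  exact abs_le.1 ((PiLp.norm_apply_le x i).trans hx)

lemma convex_unitCube (n : ℕ) : Convex ℝ (unitCube n) := by
  intro x hx y hy a b ha hb hab i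
  exact convex_Icc (-1 : ℝ) 1 (hx i) (hy i) ha hb hab

lemma isConvexBody_unitCube (n : ℕ) : IsConvexBody (unitCube n) := by
  refine ⟨convex_unitCube n, ?_, 0, ?_⟩
  · refine isCompact_of_isClosed_isBounded (isClosed_unitCube n) ?_
    refine isBounded_iff_forall_norm_le.2 ⟨√n, fun x hx => ?_⟩
    rw [EuclideanSpace.norm_eq]
    refine Real.sqrt_le_sqrt ?_
    calc ∑ i, ‖x i‖ ^ 2 ≤ ∑ _i : Fin n, (1 : ℝ) := by
          refine Finset.sum_le_sum fun i _ => ?_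
          exact pow_le_one₀ (norm_nonneg _) (abs_le.2 (hx i))
      _ = n := by simp
  · exact mem_interior_iff_mem_nhds.2
      (Filter.mem_of_superset (closedBall_mem_nhds 0 one_pos) (closedBall_subset_unitCube n))

/-- If the affine image of the unit ball lies in the cube, then the rows of the linear part have
norm at most `1`, so its determinant is at most `1` by Hadamard's inequality. -/
lemma abs_det_le_one_of_image_subset_unitCube {n : ℕ}
    (A : EuclideanSpace ℝ (Fin n) →ₗ[ℝ] EuclideanSpace ℝ (Fin n)) (b : EuclideanSpace ℝ (Fin n))
    (h : (fun x => A x + b) '' closedBall 0 1 ⊆ unitCube n) : |LinearMap.det A| ≤ 1 := by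
  set e := EuclideanSpace.basisFun (Fin n) ℝ with he
  set w : Fin n → EuclideanSpace ℝ (Fin n) := fun i => LinearMap.adjoint A (e i) with hw
  have hAx : ∀ x i, ⟪w i, x⟫ = A x i := fun x i => by
    rw [hw, LinearMap.adjoint_inner_left, he, EuclideanSpace.basisFun_inner]
  have hw1 : ∀ i, ‖w i‖ ≤ 1 := by
    intro i
    rcases eq_or_ne (w i) 0 with h0 | h0
    · rw [h0, norm_zero]
      exact zero_le_one
    have hpos : 0 < ‖w i‖ := norm_pos_iff.2 h0
    have hin : ⟪w i, ‖w i‖⁻¹ • w i⟫ = ‖w i‖ := by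
      rw [real_inner_smul_right, real_inner_self_eq_norm_sq]
      field_simp
    have hn1 : ‖‖w i‖⁻¹ • w i‖ = 1 := by simp [norm_smul, hpos.ne']
    have h1 := (h ⟨‖w i‖⁻¹ • w i, by simp [hn1], rfl⟩ i).2
    have h2 := (h ⟨-(‖w i‖⁻¹ • w i), by simp [hn1], rfl⟩ i).1
    simp only [PiLp.add_apply, ← hAx, inner_neg_right, hin] at h1 h2
    linarith
  have hdet : LinearMap.det (LinearMap.adjoint A) = LinearMap.det A := by
    rw [← LinearMap.det_toMatrix e.toBasis, LinearMap.toMatrix_adjoint, Matrix.det_conjTranspose,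
      LinearMap.det_toMatrix, star_trivial]
  have : Fact (Module.finrank ℝ (EuclideanSpace ℝ (Fin n)) = n) := ⟨by simp⟩
  have hvol := (e.toBasis.orientation).abs_volumeForm_apply_le w
  rw [Orientation.volumeForm_robust _ e rfl] at hvol
  have h3 : e.toBasis.det w = LinearMap.det A := by
    have := e.toBasis.det_comp (LinearMap.adjoint A) e.toBasis
    rw [e.toBasis.det_self, mul_one, hdet] at this
    rw [← this]
    congr 1
  rw [h3] at hvol
  exact hvol.trans (Finset.prod_le_one (fun i _ => norm_nonneg _) fun i _ => hw1 i)

theorem isJohnPosition_unitCube (n : ℕ) : IsJohnPosition (unitCube n) := by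
  refine ⟨isConvexBody_unitCube n, closedBall_subset_unitCube n, ?_⟩
  rintro _ ⟨A, b, rfl⟩ hsub
  have hdet := abs_det_le_one_of_image_subset_unitCube A.toLinearMap b hsub
  have himg : (fun x => A x + b) '' closedBall 0 1 =
      (fun x => x + b) '' (A.toLinearMap '' closedBall 0 1) := by
    rw [Set.image_image]
    rfl
  rw [himg, Set.image_add_right, measure_preimage_add_right, Measure.addHaar_image_linearMap]
  calc ENNReal.ofReal |LinearMap.det A.toLinearMap| *
        volume (closedBall (0 : EuclideanSpace ℝ (Fin n)) 1)
      ≤ 1 * volume (closedBall (0 : EuclideanSpace ℝ (Fin n)) 1) := by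
        gcongr
        exact ENNReal.ofReal_le_one.2 hdet
    _ = _ := one_mul _

/-- A relatively open facet of the cube. -/
def cubeFacet (n : ℕ) (i : Fin n) : Set (EuclideanSpace ℝ (Fin n)) :=
  {x | x i = 1 ∧ ∀ j, j ≠ i → x j ∈ Set.Ioo (-1 : ℝ) 1}

lemma cubeFacet_subset_frontier (n : ℕ) (i : Fin n) : cubeFacet n i ⊆ frontier (unitCube n) := by
  rintro x ⟨hxi, hx⟩
  have hxQ : x ∈ unitCube n := fun j => by
    rcases eq_or_ne j i with rfl | hj
    · rw [hxi]
      simp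
    · exact Set.Ioo_subset_Icc_self (hx j hj)
  refine ⟨subset_closure hxQ, fun hint => ?_⟩
  have hcont : Continuous fun s : ℝ => x + s • EuclideanSpace.single i (1 : ℝ) := by fun_prop
  have hev : ∀ᶠ s in nhds (0 : ℝ), x + s • EuclideanSpace.single i (1 : ℝ) ∈ unitCube n :=
    hcont.continuousAt.eventually_mem (by simpa using mem_interior_iff_mem_nhds.1 hint)
  obtain ⟨s, hs, hs0⟩ := ((hev.filter_mono nhdsWithin_le_nhds).and
    (self_mem_nhdsWithin (s := Set.Ioi (0 : ℝ)))).exists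
  have h1 := (hs i).2
  simp [hxi] at h1
  exact absurd h1 (not_le.2 hs0)

/-- Slicing the open cube in the direction `e i`: each slice is a translate of the facet. -/
lemma two_pow_le_two_mul_cubeFacet (n : ℕ) (i : Fin n) :
    (2 : ENNReal) ^ n ≤ 2 * μHE[n - 1] (cubeFacet n i) := by
  set Q : Set (EuclideanSpace ℝ (Fin n)) :=
    WithLp.ofLp ⁻¹' (Set.univ.pi fun _ : Fin n => Set.Ioo (-1 : ℝ) 1) with hQ
  have hQm : MeasurableSet Q :=
    (MeasurableSet.univ_pi fun _ => measurableSet_Ioo).preimage (by fun_prop)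
  have hvolQ : volume Q = 2 ^ n := by
    rw [hQ, (PiLp.volume_preserving_ofLp (Fin n)).measure_preimage
      (MeasurableSet.univ_pi fun _ => measurableSet_Ioo).nullMeasurableSet, volume_pi_pi]
    simp only [Real.volume_Ioo, Finset.prod_const, Finset.card_univ, Fintype.card_fin]
    norm_num
  set v : EuclideanSpace ℝ (Fin n) := EuclideanSpace.single i 1 with hv
  have hv1 : ‖v‖ = 1 := by simp [hv]
  have hv0 : v ≠ 0 := by
    intro h
    rw [h] at hv1
    simp at hv1
  have hslice := EuclideanGeometry.euclideanHausdorffMeasure_eq_lintegral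
    (0 : EuclideanSpace ℝ (Fin n)) hv0 hQm
  rw [InnerProductSpace.euclideanHausdorffMeasure_eq_volume, hvolQ, ← ofReal_norm, hv1,
    ENNReal.ofReal_one, one_mul, finrank_euclideanSpace_fin] at hslice
  have hle : ∀ s : ℝ, μHE[n - 1] (Q ∩ (AffineSubspace.mk' (s • v +ᵥ (0 : EuclideanSpace ℝ (Fin n)))
      (ℝ ∙ v)ᗮ : AffineSubspace ℝ (EuclideanSpace ℝ (Fin n)))) ≤
      (Set.Ioo (-1 : ℝ) 1).indicator (fun _ => μHE[n - 1] (cubeFacet n i)) s := by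
    intro s
    have hmem : ∀ x : EuclideanSpace ℝ (Fin n), x ∈ (AffineSubspace.mk'
        (s • v +ᵥ (0 : EuclideanSpace ℝ (Fin n))) (ℝ ∙ v)ᗮ) → x i = s := by
      intro x hx
      rw [AffineSubspace.mem_mk', Submodule.mem_orthogonal_singleton_iff_inner_right] at hx
      simp only [vadd_eq_add, add_zero, vsub_eq_sub, hv, EuclideanSpace.inner_single_left] at hx
      simp at hx
      linarith
    by_cases hs : s ∈ Set.Ioo (-1 : ℝ) 1
    · rw [Set.indicator_of_mem hs,
        ← measure_preimage_add (μHE[n - 1]) ((1 - s) • v) (cubeFacet n i)]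
      refine measure_mono ?_
      rintro x ⟨hxQ, hx⟩
      have hxi := hmem x hx
      refine ⟨?_, fun j hj => ?_⟩
      · simp [hv, hxi]
      · have hxj := hxQ j (Set.mem_univ j)
        simpa [hv, hj] using hxj
    · rw [Set.indicator_of_notMem hs, nonpos_iff_eq_zero]
      convert measure_empty (μ := μHE[n - 1])
      refine Set.eq_empty_of_forall_notMem ?_
      rintro x ⟨hxQ, hx⟩
      have hxi := hxQ i (Set.mem_univ i)
      rw [hmem x hx] at hxi
      exact hs hxi
  rw [hslice]
  refine (lintegral_mono hle).trans ?_
  rw [lintegral_indicator_const measurableSet_Ioo, Real.volume_Ioo, mul_comm]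
  norm_num

lemma measurableSet_cubeFacet (n : ℕ) (i : Fin n) : MeasurableSet (cubeFacet n i) := by
  simp only [cubeFacet, Set.ofPred_and, Set.ofPred_forall]
  refine MeasurableSet.inter ?_ (MeasurableSet.iInter fun j => MeasurableSet.iInter fun _ => ?_)
  · exact measurableSet_eq_fun (by fun_prop) measurable_const
  · exact measurableSet_Ioo.preimage (by fun_prop)

lemma mul_volume_unitCube_le_surfaceArea (n : ℕ) :
    n * volume (unitCube n) ≤ 2 * surfaceArea (unitCube n) := by
  have hdisj : Pairwise (Function.onFun Disjoint (cubeFacet n)) := by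
    intro i j hij
    refine Set.disjoint_left.2 fun x hxi hxj => ?_
    have h1 := (hxi.2 j hij.symm).2
    rw [hxj.1] at h1
    exact lt_irrefl _ h1
  calc n * volume (unitCube n) = ∑ _i : Fin n, (2 : ENNReal) ^ n := by
        simp [volume_unitCube]
    _ ≤ ∑ i, 2 * μHE[n - 1] (cubeFacet n i) :=
        Finset.sum_le_sum fun i _ => two_pow_le_two_mul_cubeFacet n i
    _ = 2 * μHE[n - 1] (⋃ i, cubeFacet n i) := by
        rw [measure_iUnion hdisj fun i => measurableSet_cubeFacet n i, tsum_fintype, Finset.mul_sum]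
    _ ≤ 2 * surfaceArea (unitCube n) := by
        rw [surfaceArea]
        gcongr
        exact Set.iUnion_subset fun i => cubeFacet_subset_frontier n i

lemma gauge_unitCube_le {n : ℕ} {x : EuclideanSpace ℝ (Fin n)} {r : ℝ} (hr : 0 < r)
    (hx : ∀ i, |x i| ≤ r) : gauge (unitCube n) x ≤ r := by
  refine gauge_le_of_mem hr.le ?_
  rw [Set.mem_smul_set_iff_inv_smul_mem₀ hr.ne']
  intro i
  rw [PiLp.smul_apply, smul_eq_mul, Set.mem_Icc, ← abs_le, abs_mul, abs_inv, abs_of_pos hr,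
    inv_mul_le_iff₀ hr, mul_one]
  exact hx i

lemma integral_gauge_unitCube_le {n : ℕ} (hn : 2 ≤ n) :
    ∫ x, gauge (unitCube n) x ∂stdGaussian (EuclideanSpace ℝ (Fin n)) ≤ 5 * √(Real.log n) := by
  set L := Real.log n with hL
  have hn0 : (0 : ℝ) < n := by positivity
  have hL2 : 1 / 2 ≤ L := by
    have h1 : Real.log 2 ≤ L := Real.log_le_log (by norm_num) (by exact_mod_cast hn)
    linarith [Real.log_two_gt_d9]
  -- With `t ^ 2 = 2 * log n`, the `n` terms of the exponential bound
  -- `|y| ≤ t + exp (t * (|y| - t)) / t` add up to at most `2 / t` on average.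
  set t := √(2 * L) with ht
  have htt : t ^ 2 = 2 * L := Real.sq_sqrt (by linarith)
  have ht1 : 1 ≤ t := Real.le_sqrt_of_sq_le (by linarith)
  have ht0 : 0 < t := by linarith
  set e := EuclideanSpace.basisFun (Fin n) ℝ with he
  have hmap : ∀ i, (stdGaussian (EuclideanSpace ℝ (Fin n))).map (fun x => x i) =
      gaussianReal 0 1 := fun i => by
    have h := map_inner_stdGaussian (e.norm_eq_one i)
    simpa only [he, EuclideanSpace.basisFun_inner] using h
  have hexpi : ∀ (s : ℝ) (i : Fin n), Integrable (fun x : EuclideanSpace ℝ (Fin n) =>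
      Real.exp (s * x i)) (stdGaussian (EuclideanSpace ℝ (Fin n))) := fun s i => by
    have h := integrable_exp_mul_gaussianReal (μ := 0) (v := 1) s
    rw [← hmap i] at h
    exact (integrable_map_measure (g := fun y : ℝ => Real.exp (s * y)) (by fun_prop)
      (by fun_prop)).1 h
  have hexp : ∀ (s : ℝ) (i : Fin n), ∫ x : EuclideanSpace ℝ (Fin n), Real.exp (s * x i)
      ∂stdGaussian (EuclideanSpace ℝ (Fin n)) = Real.exp (s ^ 2 / 2) := fun s i => by
    have h := mgf_gaussianReal (hmap i) s
    rw [mgf] at h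
    simpa using h
  set W : EuclideanSpace ℝ (Fin n) → ℝ := fun x => t + ∑ i, Real.exp (-t ^ 2) / t *
    (Real.exp (t * x i) + Real.exp (-t * x i)) with hW
  have hWi : ∀ i : Fin n, Integrable (fun x : EuclideanSpace ℝ (Fin n) => Real.exp (-t ^ 2) / t *
      (Real.exp (t * x i) + Real.exp (-t * x i))) (stdGaussian (EuclideanSpace ℝ (Fin n))) :=
    fun i => ((hexpi t i).add (hexpi (-t) i)).const_mul _
  have hpt : ∀ x, gauge (unitCube n) x ≤ W x := by
    intro x
    have hterm : ∀ i : Fin n, 0 ≤ Real.exp (-t ^ 2) / t *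
        (Real.exp (t * x i) + Real.exp (-t * x i)) := fun i => by positivity
    have hsum0 := Finset.sum_nonneg fun i (_ : i ∈ Finset.univ) => hterm i
    refine gauge_unitCube_le (by simp only [hW]; linarith) fun i => ?_
    have h1 := Finset.single_le_sum (fun i _ => hterm i) (Finset.mem_univ i)
    have h2 : Real.exp (t * |x i|) ≤ Real.exp (t * x i) + Real.exp (-t * x i) := by
      rcases abs_cases (x i) with h | h
      · rw [h.1]
        linarith [Real.exp_pos (-t * x i)]
      · rw [h.1, mul_neg, neg_mul]
        linarith [Real.exp_pos (t * x i)]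
    have h3 : |x i| - t ≤ Real.exp (-t ^ 2) / t * Real.exp (t * |x i|) := by
      rw [div_mul_eq_mul_div, ← Real.exp_add, le_div_iff₀ ht0]
      have := Real.add_one_le_exp (-t ^ 2 + t * |x i|)
      nlinarith
    have h4 : Real.exp (-t ^ 2) / t * Real.exp (t * |x i|) ≤ Real.exp (-t ^ 2) / t *
        (Real.exp (t * x i) + Real.exp (-t * x i)) :=
      mul_le_mul_of_nonneg_left h2 (by positivity)
    simp only [hW]
    linarith
  have hint := integral_mono (integrable_gauge_stdGaussian (convex_unitCube n)
    (closedBall_subset_unitCube n)) ((integrable_const t).add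
      (integrable_finsetSum Finset.univ fun i _ => hWi i)) hpt
  have hWint : ∫ x, W x ∂stdGaussian (EuclideanSpace ℝ (Fin n)) = t + 2 / t := by
    rw [hW, integral_add (integrable_const t) (integrable_finsetSum Finset.univ fun i _ => hWi i),
      integral_finsetSum _ fun i _ => hWi i]
    have h1 : ∀ i : Fin n, ∫ x : EuclideanSpace ℝ (Fin n), Real.exp (-t ^ 2) / t *
        (Real.exp (t * x i) + Real.exp (-t * x i)) ∂stdGaussian (EuclideanSpace ℝ (Fin n)) =
        2 / (t * n) := fun i => by
      rw [integral_const_mul, integral_add (hexpi t i) (hexpi (-t) i), hexp, hexp, neg_sq, htt,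
        mul_div_cancel_left₀ _ (two_ne_zero), Real.exp_log hn0, neg_mul_eq_mul_neg, two_mul,
        Real.exp_add, Real.exp_neg, Real.exp_log hn0]
      field_simp
      norm_num
    simp only [h1, Finset.sum_const, Finset.card_univ, Fintype.card_fin, nsmul_eq_mul,
      integral_const, probReal_univ, smul_eq_mul, one_mul]
    field_simp
  refine hint.trans (hWint.le.trans ?_)
  have h5 : 2 / t ≤ 2 * t := by
    rw [div_le_iff₀ ht0]
    nlinarith
  have h6 : t ≤ 5 / 3 * √L := by
    rw [ht, Real.sqrt_mul (by norm_num)]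
    refine mul_le_mul_of_nonneg_right ?_ (Real.sqrt_nonneg _)
    exact Real.sqrt_le_left (by norm_num) |>.2 (by norm_num)
  linarith

end Cube

/-! ### The sharp inequality -/

lemma rpow_three_halves_div {n : ℕ} (hn : 0 < n) (L : ℝ) :
    (n : ℝ) ^ (3 / 2 : ℝ) / L = n * (√n / L) := by
  have hn' : (0 : ℝ) < n := by exact_mod_cast hn
  rw [show (3 / 2 : ℝ) = 1 + 1 / 2 by norm_num, Real.rpow_add hn', Real.rpow_one,
    ← Real.sqrt_eq_rpow, mul_div_assoc]

theorem mainTheorem11 :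
    (∃ c : ℝ, 0 < c ∧ ∀ n : ℕ, 2 ≤ n → ∀ K : Set (EuclideanSpace ℝ (Fin n)), IsJohnPosition K →
      surfaceArea K ≤
        ENNReal.ofReal (c * ((n : ℝ) ^ (3 / 2 : ℝ) / √(Real.log n)) * meanGauge K) * volume K) ∧
    (∀ n : ℕ, 2 ≤ n → IsJohnPosition (unitCube n)) ∧
    (∃ c' : ℝ, 0 < c' ∧ ∀ n : ℕ, 2 ≤ n →
      ENNReal.ofReal (c' * ((n : ℝ) ^ (3 / 2 : ℝ) / √(Real.log n)) * meanGauge (unitCube n)) *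
        volume (unitCube n) ≤ surfaceArea (unitCube n)) := by
  have hlog : ∀ n : ℕ, 2 ≤ n → 0 < √(Real.log n) := fun n hn =>
    Real.sqrt_pos.2 (Real.log_pos (by exact_mod_cast hn))
  refine ⟨?_, fun n _ => isJohnPosition_unitCube n, ?_⟩
  · obtain ⟨c, hc, hcK⟩ := exists_sqrt_log_le_integral_gauge
    refine ⟨1 / c, by positivity, fun n hn K hK => ?_⟩
    -- `S(K) ≤ n |K|`, and `1 ≤ √n * M(K) / (c * √(log n))`
    have hn0 : 0 < n := by omega
    have hS := hK.isConvexBody.convex.euclideanHausdorffMeasure_frontier_le (by simpa using hn0)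
      hK.isConvexBody.isCompact hK.closedBall_subset
    rw [finrank_euclideanSpace_fin] at hS
    refine hS.trans ?_
    rw [← ENNReal.ofReal_natCast]
    gcongr
    have h1 := hcK n hn K hK
    have h2 := integral_norm_stdGaussian_le (V := EuclideanSpace ℝ (Fin n))
    rw [finrank_euclideanSpace_fin] at h2
    rw [integral_gauge_stdGaussian hn0] at h1
    have h3 := h1.trans (mul_le_mul_of_nonneg_right h2 (meanGauge_nonneg K))
    have hL := hlog n hn
    rw [rpow_three_halves_div hn0]
    have h4 : 1 ≤ 1 / c * (√n / √(Real.log n)) * meanGauge K := by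
      have : 1 / c * (√n / √(Real.log n)) * meanGauge K =
          (√n * meanGauge K) / (c * √(Real.log n)) := by
        field_simp
      rw [this, one_le_div (by positivity)]
      exact h3
    calc (n : ℝ) = n * 1 := (mul_one _).symm
      _ ≤ n * (1 / c * (√n / √(Real.log n)) * meanGauge K) := by gcongr
      _ = _ := by ring
  · have hα := gaussianAbsMean_pos
    refine ⟨gaussianAbsMean / 10, by positivity, fun n hn => ?_⟩
    have hn0 : 0 < n := by omega
    have h1 := integral_gauge_unitCube_le hn
    have h2 := le_integral_norm_stdGaussian (V := EuclideanSpace ℝ (Fin n))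
    rw [finrank_euclideanSpace_fin] at h2
    rw [integral_gauge_stdGaussian hn0] at h1
    have h3 := (mul_le_mul_of_nonneg_right h2 (meanGauge_nonneg (unitCube n))).trans h1
    have hL := hlog n hn
    have h4 : gaussianAbsMean / 10 * ((n : ℝ) ^ (3 / 2 : ℝ) / √(Real.log n)) *
        meanGauge (unitCube n) ≤ n / 2 := by
      rw [rpow_three_halves_div hn0]
      have h5 : gaussianAbsMean / 10 * (n * (√n / √(Real.log n))) * meanGauge (unitCube n) =
          n / 10 * ((gaussianAbsMean * √n * meanGauge (unitCube n)) / √(Real.log n)) := by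
        ring
      have h6 := (div_le_iff₀ hL).2 h3
      have h7 : (n : ℝ) / 10 * ((gaussianAbsMean * √n * meanGauge (unitCube n)) /
          √(Real.log n)) ≤ n / 10 * 5 := by gcongr
      rw [h5]
      linarith
    calc _ ≤ ENNReal.ofReal (n / 2) * volume (unitCube n) := by gcongr
      _ = 2⁻¹ * (n * volume (unitCube n)) := by
          rw [ENNReal.ofReal_div_of_pos (by norm_num), ENNReal.ofReal_natCast, ENNReal.ofReal_ofNat,
            div_eq_mul_inv]
          ring
      _ ≤ 2⁻¹ * (2 * surfaceArea (unitCube n)) := by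
          refine mul_le_mul' le_rfl ?_
          exact mul_volume_unitCube_le_surfaceArea n
      _ = surfaceArea (unitCube n) := by
          rw [← mul_assoc, ENNReal.inv_mul_cancel two_ne_zero ENNReal.ofNat_ne_top, one_mul]
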